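/- Let $n\ge 2$ and let $F_n$ be the free group of rank $n$. A free factor of $F_n$ is a subgroup generated by a subset of a free basis of $F_n$, and it is proper if it is not all of $F_n$. Let $S$ be the set of all separable elements of $F_n$, i.e. of all elements that lie in some proper free factor. Let $\mathrm{Cay}(F_n,S)$ be the Cayley graph with vertex set $F_n$ and an edge between $g$ and $sg$ for all $g\in F_n$, $s\in S$. Then $\mathrm{Cay}(F_n,S)$ is connected, and its vertex set, equipped with the path metric $d$, has the following property: for every $m\in\mathbb N$, $\mathbb Z^m$ (with its standard word metric, i.e. the $\ell^1$ metric) quasi-isometrically embeds into it, that is, there are a map $f:\mathbb Z^m\to F_n$ and constants $L\ge 1$, $C\ge 0$ such that $$L^{-1}\,\|x-y\|_1-C\;\le\; d(f(x),f(y))\;\le\; L\,\|x-y\|_1+C\qquad\text{for all }x,y\in\mathbb Z^m .$$ In particular, $\mathrm{Cay}(F_n,S)$ is not Gromov hyperbolic, has infinite diameter, and has infinite asymptotic dimension. -/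

import Mathlib

/-! ### Free factors and separable elements -/

/-- A subgroup of a (free) group is a free factor if it is generated by a subset of a free basis. -/
def IsFreeFactor {G : Type} [Group G] (H : Subgroup G) : Prop :=
  ∃ (ι : Type) (b : FreeGroupBasis ι G) (s : Set ι), H = Subgroup.closure (b '' s)

/-- An element is separable if it is contained in a proper free factor. -/
def IsSeparableElement {G : Type} [Group G] (g : G) : Prop :=
  ∃ H : Subgroup G, IsFreeFactor H ∧ H ≠ ⊤ ∧ g ∈ H

/-- The set of all separable elements of the free group of rank `n`. -/
def separableElements (n : ℕ) : Set (FreeGroup (Fin n)) :=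
  {g | IsSeparableElement g}

/-! ### Cayley graphs -/

/-- The Cayley graph `Cay(G, S)`: its vertices are the elements of `G`, and it has an edge between
`g` and `s * g` for all `g` in `G` and `s` in `S`. Loops (which do not affect distances) are
discarded. -/
def leftCayleyGraph {G : Type} [Group G] (S : Set G) : SimpleGraph G :=
  SimpleGraph.fromRel (fun g h => ∃ s ∈ S, s * g = h)

/-- The path metric on the vertices of a graph, as a real-valued function. -/
noncomputable def graphDist {V : Type} (Γ : SimpleGraph V) (u v : V) : ℝ :=
  (Γ.dist u v : ℝ)

/-! ### Coarse geometry

The following notions are stated for a set together with a distance function. -/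

/-- The word metric on `ℤ^m` for the standard generators, i.e. the `ℓ¹` metric. -/
noncomputable def latticeDist (m : ℕ) (x y : Fin m → ℤ) : ℝ :=
  ∑ i, |(x i : ℝ) - (y i : ℝ)|

/-- `f` is a quasi-isometric embedding: there are `L ≥ 1` and `C ≥ 0` such that
`L⁻¹ * d(x,y) - C ≤ d(f x, f y) ≤ L * d(x,y) + C` for all `x, y`. -/
def IsQuasiIsometricEmbedding {X Y : Type} (dX : X → X → ℝ) (dY : Y → Y → ℝ) (f : X → Y) : Prop :=
  ∃ L C : ℝ, 1 ≤ L ∧ 0 ≤ C ∧ ∀ x y : X,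
    L⁻¹ * dX x y - C ≤ dY (f x) (f y) ∧ dY (f x) (f y) ≤ L * dX x y + C

/-- `X` quasi-isometrically embeds into `Y`. -/
def QuasiIsometricallyEmbeds {X Y : Type} (dX : X → X → ℝ) (dY : Y → Y → ℝ) : Prop :=
  ∃ f : X → Y, IsQuasiIsometricEmbedding dX dY f

/-- The Gromov product `(x | y)_w`. -/
noncomputable def gromovProduct {X : Type} (d : X → X → ℝ) (w x y : X) : ℝ :=
  (d x w + d y w - d x y) / 2

/-- Gromov hyperbolicity:
there is `δ ≥ 0` with `(x | z)_w ≥ min ((x | y)_w) ((y | z)_w) - δ` for all `x, y, z, w`. -/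
def IsGromovHyperbolic {X : Type} (d : X → X → ℝ) : Prop :=
  ∃ δ : ℝ, 0 ≤ δ ∧ ∀ x y z w : X,
    min (gromovProduct d w x y) (gromovProduct d w y z) - δ ≤ gromovProduct d w x z

/-- Asymptotic dimension at most `k`: for every `R > 0` the space is covered by `k + 1` families of
subsets such that the members of all the families are uniformly bounded, and any two distinct
members of the same family are at distance at least `R`. -/
def AsymptoticDimensionLE {X : Type} (d : X → X → ℝ) (k : ℕ) : Prop :=
  ∀ R : ℝ, 0 < R → ∃ (𝒰 : Fin (k + 1) → Set (Set X)) (D : ℝ),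
    (∀ x, ∃ i, ∃ U ∈ 𝒰 i, x ∈ U) ∧
    (∀ i, ∀ U ∈ 𝒰 i, ∀ x ∈ U, ∀ y ∈ U, d x y ≤ D) ∧
    (∀ i, ∀ U ∈ 𝒰 i, ∀ V ∈ 𝒰 i, U ≠ V → ∀ x ∈ U, ∀ y ∈ V, R ≤ d x y)

/-- The asymptotic dimension, with value `⊤` if no finite `k` bounds it. -/
noncomputable def asymptoticDimension {X : Type} (d : X → X → ℝ) : ℕ∞ :=
  ⨅ (k : ℕ) (_ : AsymptoticDimensionLE d k), (k : ℕ∞)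

/-! # The Cayley graph of a free group with respect to its separable elements

The set `S` of separable elements is invariant under conjugation, so the word metric of `S` is
bi-invariant. Upper bounds for distances are therefore easy: `d (a * b) (c * d) ≤ d a c + d b d`.
Lower bounds come from quasimorphisms that are bounded on `S`, as these are Lipschitz functions on
the Cayley graph.

*Boundedness on `S`.* A proper free factor `H` leaves invariant, under right multiplication, an
infinite and coinfinite set `E` that is almost invariant under the whole group
(`exists_almost_invariant`): the elements whose normal form begins with a basis element not used by
`H`. In the Cayley tree of the standard basis, `E` is locally constant outside a finite set. If a
cyclically reduced `L` preserves `E`, then both ends of every translate of the axis of `L` are on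
the same side of `E`; if moreover `L` contains all positive two-letter words, these axes make enough
turns at each vertex of the tree to force `E` to be finite or cofinite (`finite_or_finite_compl`, a
form of Whitehead's cut vertex lemma). So a word `V` that contains all positive two-letter words is
not a subword of a cyclically reduced conjugate of a separable element, and counting quasimorphisms
for patterns that begin with `V` are bounded on `S`.

*The quasimorphisms.* The patterns are `V a ^ r b` for all `r` simultaneously, with arbitrary
weights `s r` in `{-1, 0, 1}`, where `V` is a positive word that begins and ends with `b`. Because a
pattern can begin inside another one only within its prefix `V` or at its last letter, the defect is
bounded independently of `s` (`abs_patternCount_append_le`). On a product of blocks `V a ^ r` with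
`r ≥ |V|` the value is the sum of the weights, up to an error of one.

*Consequences.* Let `g k` be the block with `r = |V| + k`. For two points `x`, `y` of `ℤ ^ m`, the
weights `sign (x j - y j)` show that `x ↦ ∏ g j ^ x j` is a quasi-isometric embedding. On the
vertices of the cube `{0, 1} ^ m` all constants are independent of `m`
(`exists_latticeMap_bounds`). This gives infinite asymptotic dimension by counting instead of
topology: a bounded subset of a Hamming cube of large dimension is much smaller than its
neighbourhood, so that boundedly many families of bounded, well separated sets cannot cover the
cube (`cube_coloring_bound`). For the failure of hyperbolicity, the metric on a flat
`g ^ a * h ^ b` is translation invariant, and its stable norm would be a norm on the plane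
satisfying the four-point condition with `δ = 0`, which is impossible (`not_four_point_of_norm`).
-/

/-! ### Almost invariant sets coming from free factors -/

section AlmostInvariant

variable {ι : Type}

theorem toWord_mul_of [DecidableEq ι] (g : FreeGroup ι) (i : ι) :
    g.toWord = (g * FreeGroup.of i).toWord ++ [(i, false)] ∨
      (g * FreeGroup.of i).toWord = g.toWord ++ [(i, true)] := by
  have hg : FreeGroup.IsReduced g.toWord := FreeGroup.isReduced_toWord
  have hmul : (g * FreeGroup.of i).toWord = FreeGroup.reduce (g.toWord ++ [(i, true)]) := by
    rw [FreeGroup.toWord_mul, FreeGroup.toWord_of]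
  rcases List.eq_nil_or_concat g.toWord with h | ⟨L, ⟨k, b⟩, h⟩
  · right
    rw [hmul, h]; rfl
  · rw [List.concat_eq_append] at h
    by_cases hc : k = i ∧ b = false
    · obtain ⟨rfl, rfl⟩ := hc
      left
      have hL : FreeGroup.IsReduced L := hg.infix ⟨[], [(k, false)], by simp [h]⟩
      have hgm : g = FreeGroup.mk (L ++ [(k, false)]) := by
        rw [← h, FreeGroup.mk_toWord]
      have : g * FreeGroup.of k = FreeGroup.mk L := by
        rw [hgm, ← FreeGroup.mul_mk, mul_assoc]
        have : FreeGroup.mk [(k, false)] * FreeGroup.of k = 1 := by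
          have : FreeGroup.mk [(k, false)] = (FreeGroup.of k)⁻¹ := rfl
          rw [this, inv_mul_cancel]
        rw [this, mul_one]
      rw [this, FreeGroup.toWord_mk, hL.reduce_eq, h]
    · right
      rw [hmul]
      apply FreeGroup.IsReduced.reduce_eq
      rw [FreeGroup.IsReduced, List.isChain_append]
      refine ⟨hg, by simp, ?_⟩
      intro x hx y hy hxy
      simp only [h, List.getLast?_append, List.getLast?_singleton, Option.some_or, Option.mem_def,
        Option.some.injEq, List.head?_cons] at hx hy
      subst hx hy
      simp only at hxy ⊢
      by_contra hb
      exact hc ⟨hxy, by simpa using hb⟩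

/-- If `E` is right-invariant up to a finite set under a generating set, it is so under the whole
group. -/
theorem finite_boundary_of_closure {G : Type} [Group G] {E S : Set G}
    (hS : Subgroup.closure S = ⊤) (hE : ∀ s ∈ S, {g | ¬ (g ∈ E ↔ g * s ∈ E)}.Finite) (h : G) :
    {g | ¬ (g ∈ E ↔ g * h ∈ E)}.Finite := by
  have hh : h ∈ Subgroup.closure S := hS ▸ Subgroup.mem_top h
  induction hh using Subgroup.closure_induction with
  | mem x hx => exact hE x hx
  | one => simp
  | mul x y _ _ hx hy =>
    refine (hx.union (hy.preimage (mul_left_injective x).injOn)).subset ?_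
    intro g hg
    simp only [Set.mem_union, Set.mem_preimage, Set.mem_ofPred_eq, mul_assoc] at hg ⊢
    tauto
  | inv x _ hx =>
    refine (hx.preimage (mul_left_injective x⁻¹).injOn).subset ?_
    intro g hg
    simp only [Set.mem_preimage, Set.mem_ofPred_eq, inv_mul_cancel_right] at hg ⊢
    tauto

/-- The elements of a free group whose reduced word begins with the letter `j`. -/
def beginsWith [DecidableEq ι] (j : ι) : Set (FreeGroup ι) :=
  {g | g.toWord.head? = some (j, true)}

theorem mem_beginsWith_mul_of [DecidableEq ι] {i j : ι} (g : FreeGroup ι)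
    (hg : i = j → g ≠ 1 ∧ g ≠ (FreeGroup.of j)⁻¹) :
    g ∈ beginsWith j ↔ g * FreeGroup.of i ∈ beginsWith j := by
  simp only [beginsWith, Set.mem_ofPred_eq]
  rcases toWord_mul_of g i with h | h
  · rw [h]
    rcases hL : (g * FreeGroup.of i).toWord with _ | ⟨y, L⟩
    · simp
    · simp
  · rw [h]
    rcases hL : g.toWord with _ | ⟨y, L⟩
    · have : g = 1 := FreeGroup.toWord_eq_nil_iff.1 hL
      by_cases hij : i = j
      · exact absurd this (hg hij).1
      · simp [hij]
    · simp

theorem beginsWith_infinite [DecidableEq ι] (j : ι) : (beginsWith j).Infinite := by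
  refine Set.infinite_of_injective_forall_mem (f := fun k : ℕ => FreeGroup.of j ^ (k + 1)) ?_ ?_
  · intro k l h
    have := congrArg FreeGroup.norm h
    simpa using this
  · intro k
    simp [beginsWith, FreeGroup.toWord_of_pow, List.replicate_succ]

theorem beginsWith_compl_infinite [DecidableEq ι] (j : ι) : (beginsWith j)ᶜ.Infinite := by
  refine Set.infinite_of_injective_forall_mem (f := fun k : ℕ => (FreeGroup.of j ^ k)⁻¹) ?_ ?_
  · intro k l h
    have := congrArg FreeGroup.norm h
    simpa using this
  · intro k
    simp only [beginsWith, Set.mem_compl_iff, Set.mem_ofPred_eq, FreeGroup.toWord_inv,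
      FreeGroup.toWord_of_pow]
    intro h
    have := List.mem_of_head? h
    simp [FreeGroup.invRev] at this

/-- A proper free factor `H` leaves invariant, under right multiplication, an infinite and
coinfinite set `E` which every group element leaves invariant up to a finite set: if `b` is the
basis and `b j` is not used by `H`, take the elements beginning with `b j`. -/
theorem exists_almost_invariant {G : Type} [Group G] {H : Subgroup G} (hH : IsFreeFactor H)
    (hne : H ≠ ⊤) :
    ∃ E : Set G, E.Infinite ∧ Eᶜ.Infinite ∧ (∀ h, {g | ¬ (g ∈ E ↔ g * h ∈ E)}.Finite) ∧
      ∀ h ∈ H, ∀ g, g ∈ E ↔ g * h ∈ E := by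
  classical
  obtain ⟨ι, b, s, rfl⟩ := hH
  have hgen : Subgroup.closure (Set.range b) = ⊤ := by
    have : Set.range b = b.repr.symm.toMonoidHom '' Set.range FreeGroup.of := by
      rw [← Set.range_comp]; rfl
    rw [this, ← MonoidHom.map_closure, FreeGroup.closure_range_of]
    exact Subgroup.map_top_of_surjective _ b.repr.symm.surjective
  obtain ⟨j, hj⟩ : ∃ j, j ∉ s := by
    by_contra! hs
    apply hne
    rw [Set.eq_univ_of_forall hs, Set.image_univ, hgen]
  refine ⟨b.repr ⁻¹' beginsWith j, ?_, ?_, ?_, ?_⟩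
  · exact (beginsWith_infinite j).preimage (by simp [b.repr.surjective.range_eq])
  · rw [← Set.preimage_compl]
    exact (beginsWith_compl_infinite j).preimage (by simp [b.repr.surjective.range_eq])
  · refine finite_boundary_of_closure hgen ?_
    rintro _ ⟨i, rfl⟩
    refine (Set.Finite.preimage (f := b.repr) b.repr.injective.injOn
      (s := {1, (FreeGroup.of j)⁻¹}) (by simp)).subset ?_
    intro g hg
    by_contra hcon
    apply hg
    simp only [Set.mem_preimage, map_mul, FreeGroupBasis.repr_apply_coe]
    refine mem_beginsWith_mul_of _ fun _ => ?_
    simpa [not_or] using hcon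
  · intro h hh
    induction hh using Subgroup.closure_induction with
    | mem x hx =>
      obtain ⟨i, hi, rfl⟩ := hx
      intro g
      simp only [Set.mem_preimage, map_mul, FreeGroupBasis.repr_apply_coe]
      exact mem_beginsWith_mul_of _ fun hij => absurd (hij ▸ hi) hj
    | one => simp
    | mul x y _ _ hx hy => intro g; rw [hx g, hy (g * x), mul_assoc]
    | inv x _ hx => intro g; rw [hx (g * x⁻¹), inv_mul_cancel_right]

end AlmostInvariant

/-! ### Whitehead's lemma -/

section Whitehead

open FreeGroup

variable {α : Type} [DecidableEq α]

theorem isReduced_invRev {L : List (α × Bool)} (hL : FreeGroup.IsReduced L) :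
    FreeGroup.IsReduced (invRev L) := by
  rw [isReduced_iff_reduce_eq, reduce_invRev, hL.reduce_eq]

/-- After every word there is a generator both of whose letters can be appended without
cancellation. -/
theorem exists_isReduced_append {β : Type} [Nontrivial β] {W : List (β × Bool)}
    (hW : FreeGroup.IsReduced W) :
    ∃ i, ∀ b, FreeGroup.IsReduced (W ++ [(i, b)]) := by
  rcases List.eq_nil_or_concat W with rfl | ⟨W', z, rfl⟩
  · obtain ⟨i⟩ : Nonempty β := inferInstance
    exact ⟨i, by simp⟩
  · obtain ⟨i, hi⟩ := exists_ne z.1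
    refine ⟨i, fun b => ?_⟩
    rw [FreeGroup.IsReduced, List.isChain_append]
    refine ⟨hW, by simp, ?_⟩
    simp [hi.symm]

/-- An almost invariant set is locally constant far out in the Cayley tree. -/
theorem exists_length_bound [Finite α] {E : Set (FreeGroup α)}
    (hE : ∀ h, {g | ¬ (g ∈ E ↔ g * h ∈ E)}.Finite) :
    ∃ N : ℕ, ∀ W y, FreeGroup.IsReduced W → N ≤ W.length → (mk W ∈ E ↔ mk (W ++ [y]) ∈ E) := by
  have hfin : (⋃ y : α × Bool, {g | ¬ (g ∈ E ↔ g * mk [y] ∈ E)}).Finite :=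
    Set.finite_iUnion fun y => hE _
  obtain ⟨N, hN⟩ := (hfin.image FreeGroup.norm).bddAbove
  refine ⟨N + 1, fun W y hW hlen => ?_⟩
  by_contra hcon
  have : FreeGroup.norm (mk W) ≤ N := by
    refine hN ⟨mk W, ?_, rfl⟩
    simp only [Set.mem_iUnion, Set.mem_ofPred_eq]
    exact ⟨y, by rwa [mul_mk]⟩
  rw [FreeGroup.norm, toWord_mk, hW.reduce_eq] at this
  omega

/-- A turn of the axis of a cyclically reduced word `P ++ Q`: at any vertex `W` the axis leaves in
the directions of `Q` and of `P⁻¹`, and both rays end on the same side of a set that is right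
invariant under `P ++ Q`. -/
theorem exists_same_side {E : Set (FreeGroup α)} {P Q W : List (α × Bool)} {x y : α × Bool}
    (hc : IsCyclicallyReduced (P ++ [x] ++ y :: Q))
    (hinv : ∀ g, g ∈ E ↔ g * mk (P ++ [x] ++ y :: Q) ∈ E)
    (hx : FreeGroup.IsReduced (W ++ [(x.1, !x.2)])) (hy : FreeGroup.IsReduced (W ++ [y])) (N : ℕ) :
    ∃ V V', FreeGroup.IsReduced (W ++ (x.1, !x.2) :: V) ∧ FreeGroup.IsReduced (W ++ y :: V') ∧
      N ≤ V.length ∧ N ≤ V'.length ∧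
      (mk (W ++ (x.1, !x.2) :: V) ∈ E ↔ mk (W ++ y :: V') ∈ E) := by
  set L := P ++ [x] ++ y :: Q with hL
  set R := (List.replicate N L).flatten with hR
  have hRred : FreeGroup.IsReduced (R ++ L) := by
    have := (hc.flatten_replicate (N + 1)).isReduced
    rwa [List.replicate_succ', List.flatten_append, List.flatten_singleton] at this
  have hRred' : FreeGroup.IsReduced (L ++ R) := by
    have := (hc.flatten_replicate (N + 1)).isReduced
    rwa [List.replicate_succ, List.flatten_cons] at this
  have hRlen : N ≤ R.length := by
    simp only [hR, List.length_flatten, List.map_replicate, List.sum_replicate, smul_eq_mul]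
    exact Nat.le_mul_of_pos_right _ (by simp [hL])
  have hpow : ∀ k : ℕ, ∀ g, g ∈ E ↔ g * mk L ^ k ∈ E := by
    intro k
    induction k with
    | zero => simp
    | succ k ih => intro g; rw [ih g, hinv, pow_succ, mul_assoc]
  have hmkR : mk R = mk L ^ N := by rw [hR, pow_mk]
  have hcons : (x.1, !x.2) :: invRev (R ++ P) = invRev (R ++ P ++ [x]) := by
    simp [invRev]
  refine ⟨invRev (R ++ P), Q ++ R, ?_, ?_, ?_, ?_, ?_⟩
  · have h1 : FreeGroup.IsReduced ([(x.1, !x.2)] ++ invRev (R ++ P)) := by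
      rw [List.singleton_append, hcons]
      exact isReduced_invRev (hRred.infix ⟨[], y :: Q, by simp [hL]⟩)
    simpa using hx.append_overlap h1 (by simp)
  · have h1 : FreeGroup.IsReduced ([y] ++ (Q ++ R)) :=
      hRred'.infix ⟨P ++ [x], [], by simp [hL]⟩
    simpa using hy.append_overlap h1 (by simp)
  · simp; omega
  · simp; omega
  · rw [hpow (2 * N + 1), hcons]
    have : mk (W ++ invRev (R ++ P ++ [x])) * mk L ^ (2 * N + 1) = mk (W ++ y :: (Q ++ R)) := by
      have e1 : mk (W ++ invRev (R ++ P ++ [x])) =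
          mk W * (mk L ^ N * mk (P ++ [x]))⁻¹ := by
        rw [← mul_mk, ← inv_mk, List.append_assoc, ← mul_mk, hmkR]
      have e2 : mk (W ++ y :: (Q ++ R)) = mk W * (mk (y :: Q) * mk L ^ N) := by
        rw [← hmkR, mul_mk, mul_mk]; simp
      have e3 : mk L = mk (P ++ [x]) * mk (y :: Q) := by rw [mul_mk]
      have e4 : mk (y :: Q) = (mk (P ++ [x]))⁻¹ * mk L := by rw [e3]; group
      rw [e1, e2, e4]
      group
    rw [this]

/-- Whitehead's cut vertex lemma, in terms of almost invariant sets: if all positive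
two-letter words occur in the cyclically reduced word `L`, then an almost invariant set that is
invariant under `L` is finite or cofinite. -/
theorem finite_or_finite_compl [Finite α] [Nontrivial α] {E : Set (FreeGroup α)}
    (hE : ∀ h, {g | ¬ (g ∈ E ↔ g * h ∈ E)}.Finite) {L : List (α × Bool)}
    (hc : IsCyclicallyReduced L) (hL : ∀ i j, [(i, true), (j, true)] <:+: L)
    (hinv : ∀ g, g ∈ E ↔ g * mk L ∈ E) : E.Finite ∨ Eᶜ.Finite := by
  obtain ⟨N, hN⟩ := exists_length_bound hE
  -- Membership in `E` of long reduced words is determined by a prefix of any length, by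
  -- decreasing induction on the length of the prefix.
  have key : ∀ d M, M + d = N → ∀ W V V', W.length = M → FreeGroup.IsReduced (W ++ V) →
      FreeGroup.IsReduced (W ++ V') → N ≤ (W ++ V).length → N ≤ (W ++ V').length →
      (mk (W ++ V) ∈ E ↔ mk (W ++ V') ∈ E) := by
    intro d
    induction d with
    | zero =>
      intro M hM W
      have h1 : ∀ V, W.length = M → FreeGroup.IsReduced (W ++ V) →
          (mk W ∈ E ↔ mk (W ++ V) ∈ E) := by
        intro V hW
        induction V using List.reverseRecOn with
        | nil => simp
        | append_singleton V y ih =>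
          intro hV
          rw [← List.append_assoc] at hV ⊢
          have hV' : FreeGroup.IsReduced (W ++ V) := hV.infix ⟨[], [y], by simp⟩
          rw [ih hV']
          exact hN _ _ hV' (by simp; omega)
      intro V V' hW hV hV' _ _
      rw [← h1 V hW hV, ← h1 V' hW hV']
    | succ d ih =>
      intro M hM W V V' hW hV hV' hlen hlen'
      have hWred : FreeGroup.IsReduced W := hV.infix ⟨[], V, by simp⟩
      -- `χ y` says on which side the long words beginning with `W ++ [y]` lie.
      let χ : α × Bool → Prop := fun y =>
        ∃ U, FreeGroup.IsReduced (W ++ y :: U) ∧ N ≤ (W ++ y :: U).length ∧ mk (W ++ y :: U) ∈ E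
      have hχ : ∀ y U, FreeGroup.IsReduced (W ++ y :: U) → N ≤ (W ++ y :: U).length →
          (mk (W ++ y :: U) ∈ E ↔ χ y) := by
        intro y U hU hUlen
        refine ⟨fun h => ⟨U, hU, hUlen, h⟩, ?_⟩
        rintro ⟨U', hU', hlenU', hE'⟩
        have := ih (M + 1) (by omega) (W ++ [y]) U U' (by simp [hW]) (by simpa using hU)
          (by simpa using hU') (by simpa using hUlen) (by simpa using hlenU')
        simp only [List.append_assoc, List.singleton_append] at this
        exact this.2 hE'
      have hturn : ∀ i j, FreeGroup.IsReduced (W ++ [(i, false)]) →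
          FreeGroup.IsReduced (W ++ [(j, true)]) → (χ (i, false) ↔ χ (j, true)) := by
        intro i j hi hj
        obtain ⟨P, Q, hPQ⟩ := hL i j
        have hPQ' : P ++ [(i, true)] ++ (j, true) :: Q = L := by rw [← hPQ]; simp
        rw [← hPQ'] at hc hinv
        obtain ⟨U, U', hU, hU', hlU, hlU', hUU'⟩ := exists_same_side hc hinv hi hj N
        exact (hχ _ U hU (by simp; omega)).symm.trans
          (hUU'.trans (hχ _ U' hU' (by simp; omega)))
      have hall : ∀ y z, FreeGroup.IsReduced (W ++ [y]) → FreeGroup.IsReduced (W ++ [z]) →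
          (χ y ↔ χ z) := by
        obtain ⟨i, hi⟩ := exists_isReduced_append hWred
        rintro ⟨j, b⟩ ⟨k, c⟩ hj hk
        cases b <;> cases c
        · rw [hturn j i hj (hi true), hturn k i hk (hi true)]
        · exact hturn j k hj hk
        · exact (hturn k j hk hj).symm
        · rw [← hturn i j (hi false) hj, ← hturn i k (hi false) hk]
      rcases V with _ | ⟨y, U⟩
      · simp at hlen; omega
      rcases V' with _ | ⟨z, U'⟩
      · simp at hlen'; omega
      rw [hχ y U hV hlen, hχ z U' hV' hlen']
      exact hall y z (hV.infix ⟨[], U, by simp⟩) (hV'.infix ⟨[], U', by simp⟩)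
  have hconst : ∀ g h : FreeGroup α, N ≤ g.toWord.length → N ≤ h.toWord.length →
      (g ∈ E ↔ h ∈ E) := by
    intro g h hg hh
    have := key N 0 (by omega) [] g.toWord h.toWord rfl isReduced_toWord isReduced_toWord hg hh
    simpa [mk_toWord] using this
  have hshort : {g : FreeGroup α | g.toWord.length < N}.Finite :=
    (List.finite_length_lt (α × Bool) N).preimage toWord_injective.injOn
  by_cases h : ∃ g ∈ E, N ≤ g.toWord.length
  · obtain ⟨g, hg, hgN⟩ := h
    right
    refine hshort.subset fun k hk => ?_
    by_contra hkN
    exact hk ((hconst g k hgN (by simpa using hkN)).1 hg)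
  · left
    push Not at h
    exact hshort.subset fun k hk => h k hk

/-- A cyclically reduced conjugate of a separable element does not contain all the positive
two-letter words. -/
theorem IsSeparableElement.exists_not_infix [Finite α] [Nontrivial α] {h : FreeGroup α}
    {L : List (α × Bool)} (hc : IsCyclicallyReduced L)
    (hsep : IsSeparableElement (h * mk L * h⁻¹)) : ∃ i j, ¬ [(i, true), (j, true)] <:+: L := by
  by_contra! hL
  obtain ⟨H, hH, hne, hmem⟩ := hsep
  obtain ⟨E, hE, hE', hfin, hinv⟩ := exists_almost_invariant hH hne
  -- The translate `E * h` has the same properties as `E`, and is invariant under `L`.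
  have hsurj : Function.Surjective fun k : FreeGroup α => k * h⁻¹ :=
    mul_right_surjective h⁻¹
  have hfin' : ∀ x, {g | ¬ (g ∈ (fun k => k * h⁻¹) ⁻¹' E ↔
      g * x ∈ (fun k => k * h⁻¹) ⁻¹' E)}.Finite := by
    intro x
    refine ((hfin (h * x * h⁻¹)).preimage (mul_left_injective h⁻¹).injOn).subset ?_
    intro g hg
    simpa [mul_assoc] using hg
  have hinv' : ∀ g, g ∈ (fun k => k * h⁻¹) ⁻¹' E ↔ g * mk L ∈ (fun k => k * h⁻¹) ⁻¹' E := by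
    intro g
    simpa [mul_assoc] using hinv _ hmem (g * h⁻¹)
  rcases finite_or_finite_compl hfin' hc hL hinv' with hf | hf
  · exact hE.preimage (by simp [hsurj.range_eq]) hf
  · rw [← Set.preimage_compl] at hf
    exact hE'.preimage (by simp [hsurj.range_eq]) hf

end Whitehead

/-! ### Weighted counting of patterns in words -/

section Counting

variable {β : Type} [DecidableEq β]

/-- The weight `s r` of a word that, after `k` letters `a` already read, continues with letters `a`
up to a total number `r` of them, and then with `b`; words of any other shape have weight `0`. -/
def runWeight (a b : β) (s : ℕ → ℤ) : ℕ → List β → ℤ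
  | _, [] => 0
  | k, x :: l => if x = a then runWeight a b s (k + 1) l else if x = b then s k else 0

/-- The weight of a word at its first position: `s r` if the word begins with `V a ^ r b`, and `0`
if it does not begin with a word of this form. -/
def patternWeight (a b : β) (V : List β) (s : ℕ → ℤ) (l : List β) : ℤ :=
  if V <+: l then runWeight a b s 0 (l.drop V.length) else 0

/-- The number of occurrences in a word of the patterns `V a ^ r b`, weighted by `s r`. -/
def patternCount (a b : β) (V : List β) (s : ℕ → ℤ) : List β → ℤ
  | [] => 0
  | x :: l => patternWeight a b V s (x :: l) + patternCount a b V s l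

variable {a b : β} {V : List β} {s : ℕ → ℤ}

theorem abs_runWeight_le (hs : ∀ k, |s k| ≤ 1) (k : ℕ) (l : List β) :
    |runWeight a b s k l| ≤ 1 := by
  induction l generalizing k with
  | nil => simp [runWeight]
  | cons x l ih =>
    rw [runWeight]
    split_ifs
    · exact ih _
    · exact hs _
    · simp

theorem runWeight_append {t : List β} (ht : ∃ x ∈ t, x ≠ a) (k : ℕ) (u : List β) :
    runWeight a b s k (t ++ u) = runWeight a b s k t := by
  induction t generalizing k with
  | nil => simp at ht
  | cons x t ih =>
    rw [List.cons_append, runWeight, runWeight]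
    split_ifs with hx
    · refine ih ?_ _
      obtain ⟨y, hy, hya⟩ := ht
      rcases List.mem_cons.1 hy with rfl | hy
      · exact absurd hx hya
      · exact ⟨y, hy, hya⟩
    · rfl
    · rfl

theorem runWeight_replicate_append (k r : ℕ) (u : List β) :
    runWeight a b s k (List.replicate r a ++ u) = runWeight a b s (k + r) u := by
  induction r generalizing k with
  | zero => simp
  | succ r ih =>
    rw [List.replicate_succ, List.cons_append, runWeight, if_pos rfl, ih]
    congr 1
    omega

theorem abs_patternWeight_le (hs : ∀ k, |s k| ≤ 1) (l : List β) :
    |patternWeight a b V s l| ≤ 1 := by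
  rw [patternWeight]
  split_ifs
  · exact abs_runWeight_le hs _ _
  · simp

theorem patternWeight_eq_zero {l : List β} (h : ¬ V <+: l) : patternWeight a b V s l = 0 :=
  if_neg h

/-- Appending letters to a word that is long enough changes the weight at the first position
only if the word breaks off in the run of letters `a`. -/
theorem patternWeight_append {t : List β} (hlen : V.length ≤ t.length)
    (ht : ∀ r, t ≠ V ++ List.replicate r a) (u : List β) :
    patternWeight a b V s (t ++ u) = patternWeight a b V s t := by
  by_cases hV : V <+: t
  · obtain ⟨t', rfl⟩ := hV
    rw [patternWeight, patternWeight, if_pos ⟨t' ++ u, by simp⟩, if_pos ⟨t', rfl⟩,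
      List.append_assoc, List.drop_left, List.drop_left]
    refine runWeight_append ?_ 0 u
    by_contra! hall
    exact ht t'.length (by rw [← List.eq_replicate_of_mem hall])
  · rw [patternWeight_eq_zero hV, patternWeight_eq_zero]
    exact fun h => hV (List.prefix_of_prefix_length_le h (List.prefix_append t u) hlen)

theorem patternCount_eq_zero {l : List β} (h : ¬ V <:+: l) : patternCount a b V s l = 0 := by
  induction l with
  | nil => rfl
  | cons x l ih =>
    rw [patternCount, patternWeight_eq_zero fun hp => h hp.isInfix,
      ih fun hi => h (hi.trans (List.suffix_cons x l).isInfix), add_zero]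

/-- No pattern begins in a run of letters `a`. -/
theorem patternCount_replicate_append (hab : a ≠ b) (hV : V.head? = some b) (r : ℕ) (u : List β) :
    patternCount a b V s (List.replicate r a ++ u) = patternCount a b V s u := by
  induction r with
  | zero => simp
  | succ r ih =>
    rw [List.replicate_succ, List.cons_append, patternCount, ih, patternWeight_eq_zero, zero_add]
    intro h
    rcases V with _ | ⟨v, V⟩
    · simp at hV
    · simp only [List.head?_cons, Option.some.injEq] at hV
      rw [List.cons_prefix_cons] at h
      exact hab (h.1.symm.trans hV)

theorem abs_patternCount_append_append_le (hs : ∀ k, |s k| ≤ 1) (p t u : List β) :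
    |patternCount a b V s (p ++ t ++ u) - patternCount a b V s (p ++ t) - patternCount a b V s u| ≤
      2 * p.length +
        |patternCount a b V s (t ++ u) - patternCount a b V s t - patternCount a b V s u| := by
  induction p with
  | nil => simp
  | cons x p ih =>
    simp only [List.cons_append, patternCount, List.length_cons, Nat.cast_add, Nat.cast_one]
    have h1 := abs_le.1 (abs_patternWeight_le (a := a) (b := b) (V := V) hs (x :: (p ++ t ++ u)))
    have h2 := abs_le.1 (abs_patternWeight_le (a := a) (b := b) (V := V) hs (x :: (p ++ t)))
    have h3 := abs_le.1 ih
    rw [abs_le]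
    constructor <;> linarith

/-- Pattern counting is additive under concatenation up to a bounded error. The point is that the
bound depends neither on `s` nor on the lengths of the patterns: if the first occurrence across the
cut has its prefix `V` entirely before the cut, then this prefix is followed by letters `a` up to
the cut, so that all other occurrences across the cut begin within that copy of `V`. -/
theorem abs_patternCount_append_le (hab : a ≠ b) (hV : V.head? = some b) (hs : ∀ k, |s k| ≤ 1)
    (t u : List β) :
    |patternCount a b V s (t ++ u) - patternCount a b V s t - patternCount a b V s u| ≤
      2 * V.length := by
  induction t with
  | nil => simp [patternCount]
  | cons x t ih =>
    by_cases hlen : V.length ≤ (x :: t).length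
    · by_cases ht : ∃ r, x :: t = V ++ List.replicate r a
      · obtain ⟨r, hr⟩ := ht
        rw [hr]
        refine (abs_patternCount_append_append_le hs _ _ _).trans ?_
        have h0 : patternCount a b V s (List.replicate r a) = 0 := by
          have := patternCount_replicate_append (s := s) hab hV r []
          rwa [List.append_nil] at this
        rw [patternCount_replicate_append hab hV, h0]
        simp
      · push Not at ht
        rw [List.cons_append, patternCount, patternCount, ← List.cons_append,
          patternWeight_append hlen ht]
        convert ih using 2
        ring
    · have := abs_patternCount_append_append_le (a := a) (b := b) (V := V) hs (x :: t) [] u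
      simp only [List.append_nil, List.nil_append, patternCount, sub_zero, sub_self, abs_zero,
        add_zero] at this
      refine this.trans ?_
      have : (x :: t).length ≤ V.length := by omega
      exact_mod_cast Nat.mul_le_mul_left 2 this

/-- In a concatenation of blocks `V a ^ r` with long runs, the patterns begin only at the beginnings
of the blocks. -/
theorem patternCount_block_append (hab : a ≠ b) (hV : V.head? = some b)
    (hV' : V.getLast? = some b) {r : ℕ} (hr : V.length ≤ r) (u : List β) :
    patternCount a b V s (V ++ List.replicate r a ++ u) =
      runWeight a b s r u + patternCount a b V s u := by
  -- A copy of `V` cannot begin strictly inside `V`, because its last letter would be an `a`.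
  have key : ∀ p : List β, p.length < V.length →
      patternCount a b V s (p ++ List.replicate r a ++ u) = patternCount a b V s u := by
    intro p hp
    induction p with
    | nil => simpa using patternCount_replicate_append hab hV r u
    | cons x p ih =>
      have h0 : ¬ V <+: x :: (p ++ List.replicate r a ++ u) := by
        intro h
        have h1 : V <+: (x :: p) ++ List.replicate r a :=
          List.prefix_of_prefix_length_le h ⟨u, by simp⟩ (by simp; omega)
        obtain ⟨V', rfl⟩ := List.prefix_of_prefix_length_le (List.prefix_append (x :: p) _) h1 hp.le
        rw [List.prefix_append_right_inj] at h1
        have hne : V' ≠ [] := by rintro rfl; simp at hp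
        rw [List.getLast?_append_of_ne_nil _ hne] at hV'
        exact hab (List.eq_of_mem_replicate (h1.subset (List.mem_of_getLast? hV'))).symm
      rw [List.cons_append, List.cons_append, patternCount, patternWeight_eq_zero h0, zero_add]
      exact ih (by simp at hp; omega)
  rcases V with _ | ⟨v, V⟩
  · simp at hV
  rw [List.cons_append, List.cons_append, patternCount, key V (by simp), patternWeight,
    if_pos ⟨List.replicate r a ++ u, by simp⟩, ← List.cons_append, ← List.cons_append,
    List.append_assoc, List.drop_left, runWeight_replicate_append, zero_add]

end Counting

/-! ### Counting quasimorphisms on the free group -/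

section Quasimorphism

open FreeGroup

variable {α : Type} [DecidableEq α]

/-- Reducing the concatenation of two reduced words cancels a suffix of the first with a prefix of
the second. -/
theorem exists_cancellation (g h : FreeGroup α) : ∃ p q r : List (α × Bool),
    g.toWord = p ++ q ∧ h.toWord = invRev q ++ r ∧ (g * h).toWord = p ++ r := by
  suffices H : ∀ L' L : List (α × Bool), FreeGroup.IsReduced L → FreeGroup.IsReduced L' →
      ∃ p q r, L = p ++ q ∧ L' = invRev q ++ r ∧ FreeGroup.IsReduced (p ++ r) by
    obtain ⟨p, q, r, hg, hh, hred⟩ := H h.toWord g.toWord isReduced_toWord isReduced_toWord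
    refine ⟨p, q, r, hg, hh, ?_⟩
    have : g * h = mk (p ++ r) := by
      rw [← mk_toWord (x := g), ← mk_toWord (x := h), hg, hh, ← mul_mk, ← mul_mk, ← mul_mk,
        ← inv_mk]
      group
    rw [this, toWord_mk, hred.reduce_eq]
  intro L'
  induction L' with
  | nil => exact fun L hL _ => ⟨L, [], [], by simp, by simp, by simpa using hL⟩
  | cons y L' ih =>
    intro L hL hL'
    by_cases hLy : FreeGroup.IsReduced (L ++ [y])
    · exact ⟨L, [], y :: L', by simp, by simp,
        by simpa using hLy.append_overlap (L₃ := L') hL' (by simp)⟩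
    · rcases List.eq_nil_or_concat L with rfl | ⟨L₀, z, rfl⟩
      · simp at hLy
      rw [List.concat_eq_append] at hL hLy ⊢
      have hz : y = (z.1, !z.2) := by
        by_contra hne
        apply hLy
        rw [FreeGroup.IsReduced, List.isChain_append]
        refine ⟨hL, by simp, ?_⟩
        simp only [List.getLast?_append, List.getLast?_singleton, Option.some_or, Option.mem_def,
          Option.some.injEq, List.head?_cons, forall_eq']
        intro h1
        by_contra h2
        apply hne
        ext
        · exact h1.symm
        · cases hz : z.2 <;> cases hy : y.2 <;> simp_all
      obtain ⟨p, q, r, hp, hq, hred⟩ := ih L₀ (hL.infix ⟨[], [z], by simp⟩)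
        (hL'.infix ⟨[y], [], by simp⟩)
      exact ⟨p, q ++ [z], r, by simp [hp], by simp [hq, hz, invRev], hred⟩

theorem isCyclicallyReduced_invRev {L : List (α × Bool)} (hL : IsCyclicallyReduced L) :
    IsCyclicallyReduced (invRev L) := by
  refine ⟨isReduced_invRev hL.isReduced, fun x hx y hy hxy => ?_⟩
  simp only [invRev, List.getLast?_reverse, List.head?_reverse, List.head?_map,
    List.getLast?_map, Option.mem_def, Option.map_eq_some_iff] at hx hy
  obtain ⟨x', hx', rfl⟩ := hx
  obtain ⟨y', hy', rfl⟩ := hy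
  simp only at hxy ⊢
  rw [hL.2 y' hy' x' hx' hxy.symm]

/-- The quasimorphism counting the patterns `V a ^ r b`, weighted by `s r`, with sign. -/
def patternQuasi (a b : α × Bool) (V : List (α × Bool)) (s : ℕ → ℤ) (g : FreeGroup α) : ℤ :=
  patternCount a b V s g.toWord - patternCount a b V s (g⁻¹).toWord

variable {a b : α × Bool} {V : List (α × Bool)} {s : ℕ → ℤ}

theorem patternQuasi_inv (g : FreeGroup α) :
    patternQuasi a b V s g⁻¹ = -patternQuasi a b V s g := by
  simp [patternQuasi]

theorem abs_patternQuasi_mul_le (hab : a ≠ b) (hV : V.head? = some b) (hs : ∀ k, |s k| ≤ 1)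
    (g h : FreeGroup α) :
    |patternQuasi a b V s (g * h) - patternQuasi a b V s g - patternQuasi a b V s h| ≤
      12 * V.length := by
  obtain ⟨p, q, r, hg, hh, hgh⟩ := exists_cancellation g h
  simp only [patternQuasi, toWord_inv, hg, hh, hgh, invRev_append, invRev_invRev]
  have := fun t u => abs_le.1 (abs_patternCount_append_le hab hV hs t u)
  have h1 := this p q
  have h2 := this (invRev q) r
  have h3 := this p r
  have h4 := this (invRev q) (invRev p)
  have h5 := this (invRev r) q
  have h6 := this (invRev r) (invRev p)
  rw [abs_le]
  constructor <;> linarith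

/-- The pattern-counting quasimorphism is bounded on the separable elements, by Whitehead's
lemma. -/
theorem abs_patternQuasi_le_of_separable [Finite α] [Nontrivial α] (hab : a ≠ b)
    (hV : V.head? = some b) (hs : ∀ k, |s k| ≤ 1) (hpairs : ∀ i j, [(i, true), (j, true)] <:+: V)
    {g : FreeGroup α} (hg : IsSeparableElement g) :
    |patternQuasi a b V s g| ≤ 24 * V.length := by
  set L := reduceCyclically g.toWord with hL
  set h := mk (reduceCyclically.conjugator g.toWord) with hh
  have hLc : IsCyclicallyReduced L := reduceCyclically.isCyclicallyReduced isReduced_toWord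
  have hgh : h * mk L * h⁻¹ = g := by
    rw [hh, inv_mk, mul_mk, mul_mk, reduceCyclically.conj_conjugator_reduceCyclically, mk_toWord]
  have hinvRev : IsCyclicallyReduced (invRev L) := isCyclicallyReduced_invRev hLc
  have h1 : ¬ V <:+: L := by
    rw [← hgh] at hg
    obtain ⟨i, j, hij⟩ := hg.exists_not_infix hLc
    exact fun h => hij ((hpairs i j).trans h)
  have h2 : ¬ V <:+: invRev L := by
    obtain ⟨H, hH, hne, hmem⟩ := hg
    have : IsSeparableElement (h * mk (invRev L) * h⁻¹) := by
      refine ⟨H, hH, hne, ?_⟩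
      have : h * mk (invRev L) * h⁻¹ = g⁻¹ := by rw [← hgh, ← inv_mk]; group
      rw [this]
      exact H.inv_mem hmem
    obtain ⟨i, j, hij⟩ := this.exists_not_infix hinvRev
    exact fun h => hij ((hpairs i j).trans h)
  have h0 : patternQuasi a b V s (mk L) = 0 := by
    rw [patternQuasi, toWord_inv, toWord_mk, hLc.isReduced.reduce_eq, patternCount_eq_zero h1,
      patternCount_eq_zero h2, sub_zero]
  have e1 := abs_le.1 (abs_patternQuasi_mul_le hab hV hs (h * mk L) h⁻¹)
  have e2 := abs_le.1 (abs_patternQuasi_mul_le hab hV hs h (mk L))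
  rw [hgh, patternQuasi_inv] at e1
  rw [h0] at e2
  rw [abs_le]
  constructor <;> linarith

/-- On a product of elements `V a ^ r` with `r ≥ |V|`, the quasimorphism is the sum of the weights,
up to an error of `1` from the last factor. -/
theorem abs_patternQuasi_prod_le {i j : α} (hij : i ≠ j)
    (hV : V.head? = some (j, true)) (hV' : V.getLast? = some (j, true)) (hpos : ∀ x ∈ V, x.2 = true)
    (hs : ∀ k, |s k| ≤ 1) (ks : List ℕ) (hks : ∀ k ∈ ks, V.length ≤ k) :
    |patternQuasi (i, true) (j, true) V s ((ks.map fun k => mk V * of i ^ k).prod) -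
      (ks.map s).sum| ≤ 1 := by
  have hab : (i, true) ≠ (j, true) := by simpa using hij
  set w : List ℕ → List (α × Bool) :=
    fun ks => (ks.map fun k => V ++ List.replicate k (i, true)).flatten with hw
  have hprod : (ks.map fun k => mk V * of i ^ k).prod = mk (w ks) := by
    clear hks
    induction ks with
    | nil => rfl
    | cons k ks ih =>
      have : of i ^ k = mk (List.replicate k (i, true)) := by
        rw [← mk_toWord (x := of i ^ k), toWord_of_pow]
      simp only [List.map_cons, List.prod_cons, ih, hw, List.flatten_cons, ← mul_mk, this]
  have hwpos : ∀ x ∈ w ks, x.2 = true := by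
    intro x hx
    simp only [hw, List.mem_flatten, List.mem_map] at hx
    obtain ⟨_, ⟨k, _, rfl⟩, hx⟩ := hx
    rcases List.mem_append.1 hx with hx | hx
    · exact hpos x hx
    · rw [List.eq_of_mem_replicate hx]
  have hred : FreeGroup.IsReduced (w ks) := by
    refine (List.pairwise_of_forall_mem_list fun x hx y hy _ => ?_).isChain
    rw [hwpos x hx, hwpos y hy]
  have hneg : patternCount (i, true) (j, true) V s (invRev (w ks)) = 0 := by
    apply patternCount_eq_zero
    intro h
    have hj : (j, true) ∈ invRev (w ks) := h.subset (List.mem_of_head? hV)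
    simp only [invRev, List.mem_reverse, List.mem_map] at hj
    obtain ⟨x, hx, hxj⟩ := hj
    have := hwpos x hx
    simp [this] at hxj
  rw [hprod, patternQuasi, toWord_inv, toWord_mk, hred.reduce_eq, hneg, sub_zero]
  clear hprod hwpos hred hneg
  induction ks with
  | nil => simp [hw, patternCount]
  | cons k ks ih =>
    have e : w (k :: ks) = V ++ List.replicate k (i, true) ++ w ks := by simp [hw]
    rw [e, patternCount_block_append hab hV hV' (hks k (by simp))]
    rcases ks with _ | ⟨k', ks⟩
    · simpa [hw, runWeight, patternCount] using hs k
    · have hrun : runWeight (i, true) (j, true) s k (w (k' :: ks)) = s k := by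
        rcases V with _ | ⟨v, V⟩
        · simp at hV
        · simp only [List.head?_cons, Option.some.injEq] at hV
          simp [hw, runWeight, hV, hij.symm]
      have := ih (fun l hl => hks l (List.mem_cons_of_mem _ hl))
      rw [hrun, List.map_cons, List.sum_cons]
      convert this using 2
      ring

/-- A positive word that begins and ends with `j` and contains all positive two-letter words. -/
theorem exists_word {γ : Type} [Finite γ] (j : γ) :
    ∃ V : List (γ × Bool), V.head? = some (j, true) ∧ V.getLast? = some (j, true) ∧
      (∀ x ∈ V, x.2 = true) ∧
      ∀ k l, [(k, true), (l, true)] <:+: V := by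
  have := Fintype.ofFinite γ
  let P : List (List (γ × Bool)) :=
    (Finset.univ : Finset (γ × γ)).toList.map fun p => [(p.1, true), (p.2, true)]
  refine ⟨(j, true) :: (P.flatten ++ [(j, true)]), rfl, ?_, ?_, ?_⟩
  · rw [← List.cons_append, List.getLast?_concat]
  · intro x hx
    simp only [List.mem_cons, List.mem_append, List.mem_flatten, P, List.mem_map] at hx
    rcases hx with rfl | ⟨_, ⟨p, _, rfl⟩, hx⟩ | rfl | hx
    · rfl
    · simp at hx; rcases hx with rfl | rfl <;> rfl
    · rfl
    · simp at hx
  · intro k l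
    have hmem : [(k, true), (l, true)] ∈ P := List.mem_map.2 ⟨(k, l), by simp, rfl⟩
    exact (List.infix_of_mem_flatten hmem).trans ⟨[(j, true)], [(j, true)], by simp⟩

end Quasimorphism

/-! ### Cayley graphs of conjugation-invariant generating sets -/

section Cayley

theorem graphDist_triangle {X : Type} {Γ : SimpleGraph X} (hΓ : Γ.Connected) (u v w : X) :
    graphDist Γ u w ≤ graphDist Γ u v + graphDist Γ v w := by
  unfold graphDist
  exact_mod_cast hΓ.dist_triangle

theorem graphDist_comm {X : Type} (Γ : SimpleGraph X) (u v : X) :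
    graphDist Γ u v = graphDist Γ v u := by
  rw [graphDist, graphDist, SimpleGraph.dist_comm]

theorem graphDist_nonneg {X : Type} (Γ : SimpleGraph X) (u v : X) : 0 ≤ graphDist Γ u v :=
  Nat.cast_nonneg _

theorem graphDist_self {X : Type} (Γ : SimpleGraph X) (u : X) : graphDist Γ u u = 0 := by
  simp [graphDist]

theorem graphDist_map_le {X Y : Type} {Γ : SimpleGraph X} {Γ' : SimpleGraph Y} (hΓ : Γ.Connected)
    (f : Γ →g Γ') (u v : X) : graphDist Γ' (f u) (f v) ≤ graphDist Γ u v := by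
  obtain ⟨p, hp⟩ := hΓ.exists_walk_length_eq_dist u v
  rw [graphDist, graphDist, ← hp, ← p.length_map f]
  exact_mod_cast SimpleGraph.dist_le _

theorem abs_sub_le_mul_graphDist {X : Type} {Γ : SimpleGraph X} (hΓ : Γ.Connected) {q : X → ℝ}
    {B : ℝ} (hq : ∀ u v, Γ.Adj u v → |q u - q v| ≤ B) (u v : X) :
    |q u - q v| ≤ B * graphDist Γ u v := by
  obtain ⟨p, hp⟩ := hΓ.exists_walk_length_eq_dist u v
  rw [graphDist, ← hp]
  clear hp
  induction p with
  | nil => simp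
  | cons h p ih =>
    have := abs_sub_le (q _) (q _) (q _) |>.trans (add_le_add (hq _ _ h) ih)
    refine this.trans (le_of_eq ?_)
    simp only [SimpleGraph.Walk.length_cons, Nat.cast_add, Nat.cast_one]
    ring

variable {G : Type} [Group G] {S : Set G}

theorem leftCayleyGraph_adj {u v : G} :
    (leftCayleyGraph S).Adj u v ↔ u ≠ v ∧ ((∃ s ∈ S, s * u = v) ∨ ∃ s ∈ S, s * v = u) :=
  SimpleGraph.fromRel_adj _ _ _

theorem leftCayleyGraph_reachable_mul {s : G} (hs : s ∈ S) (u : G) :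
    (leftCayleyGraph S).Reachable u (s * u) := by
  by_cases h : u = s * u
  · rw [← h]
  · exact (leftCayleyGraph_adj.2 ⟨h, Or.inl ⟨s, hs, rfl⟩⟩).reachable

theorem leftCayleyGraph_connected (hS : Subgroup.closure S = ⊤) :
    (leftCayleyGraph S).Connected := by
  have key : ∀ g ∈ Subgroup.closure S, ∀ u, (leftCayleyGraph S).Reachable u (g * u) := by
    intro g hg
    induction hg using Subgroup.closure_induction with
    | mem s hs => exact leftCayleyGraph_reachable_mul hs
    | one => simp
    | mul x y _ _ hx hy => intro u; rw [mul_assoc]; exact (hy u).trans (hx _)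
    | inv x _ hx => intro u; simpa using (hx (x⁻¹ * u)).symm
  have : Nonempty G := ⟨1⟩
  refine ⟨fun u v => ?_⟩
  simpa using key (v * u⁻¹) (hS ▸ Subgroup.mem_top _) u

theorem graphDist_one_le_one {s : G} (hs : s ∈ S) : graphDist (leftCayleyGraph S) 1 s ≤ 1 := by
  by_cases h : 1 = s
  · rw [← h, graphDist_self]; exact zero_le_one
  · rw [graphDist, SimpleGraph.dist_eq_one_iff_adj.2
      (leftCayleyGraph_adj.2 ⟨h, Or.inl ⟨s, hs, mul_one s⟩⟩), Nat.cast_one]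

/-- Right multiplication is an automorphism of the (left) Cayley graph. -/
theorem graphDist_mul_right (hS : Subgroup.closure S = ⊤) (u v k : G) :
    graphDist (leftCayleyGraph S) (u * k) (v * k) = graphDist (leftCayleyGraph S) u v := by
  have key : ∀ u v k : G,
      graphDist (leftCayleyGraph S) (u * k) (v * k) ≤ graphDist (leftCayleyGraph S) u v := by
    intro u v k
    refine graphDist_map_le (leftCayleyGraph_connected hS)
      (⟨fun g => g * k, fun {x y} h => ?_⟩ : leftCayleyGraph S →g leftCayleyGraph S) u v
    rw [leftCayleyGraph_adj] at h ⊢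
    simpa [← mul_assoc] using h
  refine (key u v k).antisymm ?_
  simpa using key (u * k) (v * k) k⁻¹

/-- Left multiplication is an automorphism of the (left) Cayley graph of a conjugation-invariant
set. -/
theorem graphDist_mul_left (hS : Subgroup.closure S = ⊤) (hconj : ∀ s ∈ S, ∀ g, g * s * g⁻¹ ∈ S)
    (k u v : G) :
    graphDist (leftCayleyGraph S) (k * u) (k * v) = graphDist (leftCayleyGraph S) u v := by
  have key : ∀ k u v : G,
      graphDist (leftCayleyGraph S) (k * u) (k * v) ≤ graphDist (leftCayleyGraph S) u v := by
    intro k u v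
    refine graphDist_map_le (leftCayleyGraph_connected hS)
      (⟨fun g => k * g, fun {x y} h => ?_⟩ : leftCayleyGraph S →g leftCayleyGraph S) u v
    rw [leftCayleyGraph_adj] at h ⊢
    refine ⟨by simpa using h.1, ?_⟩
    rcases h.2 with ⟨s, hs, h⟩ | ⟨s, hs, h⟩
    · exact Or.inl ⟨k * s * k⁻¹, hconj s hs k, by rw [← h]; group⟩
    · exact Or.inr ⟨k * s * k⁻¹, hconj s hs k, by rw [← h]; group⟩
  refine (key k u v).antisymm ?_
  simpa using key k⁻¹ (k * u) (k * v)

theorem graphDist_mul_mul_le (hS : Subgroup.closure S = ⊤)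
    (hconj : ∀ s ∈ S, ∀ g, g * s * g⁻¹ ∈ S) (a b c d : G) :
    graphDist (leftCayleyGraph S) (a * b) (c * d) ≤
      graphDist (leftCayleyGraph S) a c + graphDist (leftCayleyGraph S) b d := by
  refine (graphDist_triangle (leftCayleyGraph_connected hS) _ (c * b) _).trans ?_
  rw [graphDist_mul_right hS, graphDist_mul_left hS hconj]

theorem graphDist_one_pow_le (hS : Subgroup.closure S = ⊤)
    (hconj : ∀ s ∈ S, ∀ g, g * s * g⁻¹ ∈ S) (g : G) (k : ℕ) :
    graphDist (leftCayleyGraph S) 1 (g ^ k) ≤ k * graphDist (leftCayleyGraph S) 1 g := by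
  induction k with
  | zero => simp [graphDist_self]
  | succ k ih =>
    have := graphDist_mul_mul_le hS hconj 1 1 (g ^ k) g
    rw [mul_one, ← pow_succ] at this
    push_cast
    linarith

theorem graphDist_zpow_le (hS : Subgroup.closure S = ⊤)
    (hconj : ∀ s ∈ S, ∀ g, g * s * g⁻¹ ∈ S) (g : G) (j k : ℤ) :
    graphDist (leftCayleyGraph S) (g ^ j) (g ^ k) ≤
      |(j : ℝ) - k| * graphDist (leftCayleyGraph S) 1 g := by
  wlog h : j ≤ k generalizing j k
  · rw [graphDist_comm, abs_sub_comm]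
    exact this k j (by omega)
  obtain ⟨r, rfl⟩ := Int.le.dest h
  have := graphDist_one_pow_le hS hconj g r
  rw [← graphDist_mul_left hS hconj (g ^ j), mul_one, ← zpow_natCast, ← zpow_add] at this
  simpa using this

theorem graphDist_prod_ofFn_le {m : ℕ} (hS : Subgroup.closure S = ⊤)
    (hconj : ∀ s ∈ S, ∀ g, g * s * g⁻¹ ∈ S) (u v : Fin m → G) :
    graphDist (leftCayleyGraph S) (List.ofFn u).prod (List.ofFn v).prod ≤
      ∑ i, graphDist (leftCayleyGraph S) (u i) (v i) := by
  induction m with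
  | zero => simp [graphDist_self]
  | succ m ih =>
    rw [List.ofFn_succ, List.ofFn_succ, List.prod_cons, List.prod_cons, Fin.sum_univ_succ]
    exact (graphDist_mul_mul_le hS hconj _ _ _ _).trans (add_le_add_right (ih _ _) _)

theorem graphDist_one_mul_comm (hS : Subgroup.closure S = ⊤)
    (hconj : ∀ s ∈ S, ∀ g, g * s * g⁻¹ ∈ S) (g h : G) :
    graphDist (leftCayleyGraph S) 1 (g * h) = graphDist (leftCayleyGraph S) 1 (h * g) := by
  rw [← graphDist_mul_left hS hconj g⁻¹, ← graphDist_mul_right hS _ _ g]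
  simp

end Cayley

/-! ### Separable elements generate and are conjugation invariant -/

section Separable

theorem IsFreeFactor.map_equiv {G G' : Type} [Group G] [Group G'] {H : Subgroup G}
    (hH : IsFreeFactor H) (e : G ≃* G') : IsFreeFactor (H.map e.toMonoidHom) := by
  obtain ⟨ι, b, s, rfl⟩ := hH
  refine ⟨ι, b.map e, s, ?_⟩
  rw [MonoidHom.map_closure, ← Set.image_comp]
  congr 1

theorem IsSeparableElement.map_equiv {G G' : Type} [Group G] [Group G'] {g : G}
    (hg : IsSeparableElement g) (e : G ≃* G') : IsSeparableElement (e g) := by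
  obtain ⟨H, hH, hne, hmem⟩ := hg
  refine ⟨H.map e.toMonoidHom, hH.map_equiv e, fun h => hne ?_, Subgroup.mem_map_of_mem _ hmem⟩
  rw [eq_top_iff]
  intro x _
  have hx : e x ∈ H.map e.toMonoidHom := h ▸ Subgroup.mem_top _
  obtain ⟨y, hy, hyx⟩ := hx
  rwa [← e.injective hyx]

theorem isSeparableElement_conj {G : Type} [Group G] {g : G} (hg : IsSeparableElement g) (h : G) :
    IsSeparableElement (h * g * h⁻¹) := by
  simpa using hg.map_equiv (MulAut.conj h)

theorem isSeparableElement_of_pow {α : Type} [Nontrivial α] (i : α) (k : ℕ) :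
    IsSeparableElement (FreeGroup.of i ^ k) := by
  classical
  refine ⟨Subgroup.closure (FreeGroupBasis.ofFreeGroup α '' {i}), ⟨α, _, {i}, rfl⟩, ?_, ?_⟩
  · obtain ⟨j, hj⟩ := exists_ne i
    intro h
    -- The homomorphism counting the letters `j` vanishes on `of i` but not on `of j`.
    let φ : FreeGroup α →* Multiplicative ℤ :=
      FreeGroup.lift fun k => Multiplicative.ofAdd (if k = j then 1 else 0)
    have hle : Subgroup.closure (FreeGroupBasis.ofFreeGroup α '' {i}) ≤ φ.ker := by
      rw [Subgroup.closure_le]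
      rintro _ ⟨k, rfl, rfl⟩
      simp [φ, FreeGroupBasis.ofFreeGroup_apply, MonoidHom.mem_ker, hj.symm]
    have hmem : FreeGroup.of j ∈ φ.ker := hle (h ▸ Subgroup.mem_top _)
    simp [φ, MonoidHom.mem_ker] at hmem
  · have hi : FreeGroup.of i ∈ FreeGroupBasis.ofFreeGroup α '' {i} :=
      ⟨i, rfl, FreeGroupBasis.ofFreeGroup_apply i⟩
    exact Subgroup.pow_mem _ (Subgroup.subset_closure hi) k

theorem closure_isSeparableElement (α : Type) [Nontrivial α] :
    Subgroup.closure {g : FreeGroup α | IsSeparableElement g} = ⊤ := by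
  rw [eq_top_iff, ← FreeGroup.closure_range_of]
  refine Subgroup.closure_mono ?_
  rintro _ ⟨i, rfl⟩
  simpa using isSeparableElement_of_pow i 1

end Separable

/-! ### Asymptotic dimension of Hamming cubes -/

section Cubes

theorem hammingDist_update {m : ℕ} (x : Fin m → Bool) (j : Fin m) :
    hammingDist x (Function.update x j (!x j)) = 1 := by
  rw [hammingDist, Finset.card_eq_one]
  refine ⟨j, ?_⟩
  ext i
  by_cases h : i = j
  · subst h; simp
  · simp [h]

/-- The combinatorial core: if the vertices of the `m`-cube have a base point each (at distance at
most `r`), and a colour, such that the base points of two neighbours of a vertex agree as soon as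
these have the same colour, then `m` is bounded in terms of `r` and the number of colours. Indeed
each vertex has at least `m - r` edges leading away from its base point, whereas at most `r + 1`
such edges of a given colour lead to a given vertex. -/
theorem cube_coloring_bound {m r k : ℕ} (base : (Fin m → Bool) → (Fin m → Bool))
    (col : (Fin m → Bool) → Fin (k + 1)) (hr : ∀ x, hammingDist x (base x) ≤ r)
    (hbase : ∀ y i j, col (Function.update y i (!y i)) = col (Function.update y j (!y j)) →
      base (Function.update y i (!y i)) = base (Function.update y j (!y j))) :
    m ≤ r + (k + 1) * (r + 1) := by
  classical
  let A : Finset (Σ _ : Fin m → Bool, Fin m) :=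
    Finset.univ.sigma fun x => Finset.univ.filter fun j => x j = base x j
  let F : (Σ _ : Fin m → Bool, Fin m) → Fin (k + 1) × (Fin m → Bool) :=
    fun p => (col p.1, Function.update p.1 p.2 (!p.1 p.2))
  have hlower : 2 ^ m * (m - r) ≤ A.card := by
    rw [Finset.card_sigma]
    have : ∀ x ∈ (Finset.univ : Finset (Fin m → Bool)),
        m - r ≤ (Finset.univ.filter fun j => x j = base x j).card := by
      intro x _
      have h1 := Finset.card_filter_add_card_filter_not (s := (Finset.univ : Finset (Fin m)))
        (fun j => x j = base x j)
      have h2 := hr x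
      rw [hammingDist] at h2
      simp only [Finset.card_univ, Fintype.card_fin] at h1
      simp only [ne_eq] at h2
      omega
    have := Finset.card_nsmul_le_sum _ _ _ this
    simpa using this
  have hfib : ∀ q ∈ (Finset.univ : Finset (Fin (k + 1) × (Fin m → Bool))),
      (A.filter fun p => F p = q).card ≤ r + 1 := by
    rintro ⟨c, y⟩ -
    by_cases hne : (A.filter fun p => F p = (c, y)).Nonempty
    · -- All elements of the fibre have the same base point `base x`.
      obtain ⟨⟨x, j⟩, hxj⟩ := hne
      simp only [A, F, Finset.mem_filter, Finset.mem_sigma, Finset.mem_univ, true_and,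
        Prod.mk.injEq] at hxj
      obtain ⟨hxj1, hxj2, hxj3⟩ := hxj
      have hy : ∀ x' j', Function.update x' j' (!x' j') = y →
          x' = Function.update y j' (!y j') := by
        rintro x' j' rfl
        simp
      have hdist : hammingDist y (base x) ≤ r + 1 := by
        have := hammingDist_triangle y x (base x)
        have h1 : hammingDist y x = 1 := by
          rw [hammingDist_comm, ← hxj3]; exact hammingDist_update x j
        have := hr x
        omega
      refine le_trans ?_ hdist
      rw [hammingDist]
      refine Finset.card_le_card_of_injOn (fun p => p.2) ?_ ?_
      · rintro ⟨x', j'⟩ h'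
        simp only [A, F, Finset.coe_filter, Finset.mem_sigma, Finset.mem_univ, Finset.mem_filter,
          true_and, Prod.mk.injEq, Set.mem_ofPred_eq] at h'
        obtain ⟨h1, h2, h3⟩ := h'
        have hb : base x' = base x := by
          rw [hy _ _ h3, hy _ _ hxj3]
          apply hbase
          rw [← hy _ _ h3, ← hy _ _ hxj3, h2, hxj2]
        simp only [Finset.coe_filter, Finset.mem_univ, true_and, Set.mem_ofPred_eq]
        rw [← h3, ← hb, ← h1]
        simp
      · rintro ⟨x₁, j₁⟩ h₁ ⟨x₂, j₂⟩ h₂ h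
        simp only [F, Finset.coe_filter, Prod.mk.injEq, Set.mem_ofPred_eq] at h₁ h₂ h
        subst h
        rw [hy _ _ h₁.2.2, hy _ _ h₂.2.2]
    · rw [Finset.not_nonempty_iff_eq_empty.1 hne]
      simp
  have hupper := Finset.card_le_mul_card_image_of_maps_to
    (s := A) (t := Finset.univ) (f := F) (fun _ _ => Finset.mem_univ _) (r + 1) hfib
  simp only [Finset.card_univ, Fintype.card_prod, Fintype.card_fin, Fintype.card_pi,
    Fintype.card_bool, Finset.prod_const] at hupper
  have h := hlower.trans hupper
  have h' : 2 ^ m * (m - r) ≤ 2 ^ m * ((k + 1) * (r + 1)) := by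
    refine h.trans (le_of_eq ?_); ring
  have := Nat.le_of_mul_le_mul_left h' (by positivity)
  omega

/-- A space that contains all Hamming cubes, coarsely embedded with uniform control, has no finite
asymptotic dimension. -/
theorem not_asymptoticDimensionLE_of_cubes {X : Type} {d : X → X → ℝ}
    (htri : ∀ u v w, d u w ≤ d u v + d v w) (hsymm : ∀ u v, d u v = d v u) {K A C : ℝ}
    (hK : 0 ≤ K) (hA : 0 ≤ A)
    (hf : ∀ m : ℕ, ∃ f : (Fin m → Bool) → X, (∀ x y, d (f x) (f y) ≤ K * hammingDist x y) ∧
      ∀ x y, (hammingDist x y : ℝ) ≤ A * d (f x) (f y) + C) (k : ℕ) :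
    ¬ AsymptoticDimensionLE d k := by
  intro h
  obtain ⟨𝒰, D, hcov, hbdd, hsep⟩ := h (2 * K + 1) (by linarith)
  obtain ⟨r, hr⟩ := exists_nat_ge (A * D + C)
  obtain ⟨f, hf1, hf2⟩ := hf (r + (k + 1) * (r + 1) + 1)
  choose col U hU hmem using hcov
  -- The base point depends only on the chosen set.
  let pt : Set X → (Fin (r + (k + 1) * (r + 1) + 1) → Bool) :=
    fun W => if h : ∃ x, U (f x) = W then h.choose else default
  have hpt : ∀ x, U (f (pt (U (f x)))) = U (f x) := by
    intro x
    have h : ∃ x', U (f x') = U (f x) := ⟨x, rfl⟩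
    simp only [pt, dif_pos h]
    exact h.choose_spec
  have := cube_coloring_bound (r := r) (k := k) (fun x => pt (U (f x))) (fun x => col (f x)) ?_ ?_
  · omega
  · intro x
    have h1 := hf2 x (pt (U (f x)))
    have h2 : d (f x) (f (pt (U (f x)))) ≤ D :=
      hbdd _ _ (hU (f x)) _ (hmem _) _ (by have := hmem (f (pt (U (f x)))); rwa [hpt] at this)
    have h3 : (hammingDist x (pt (U (f x))) : ℝ) ≤ r :=
      h1.trans ((add_le_add_left (mul_le_mul_of_nonneg_left h2 hA) C).trans hr)
    exact_mod_cast h3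
  · intro y i j hij
    congr 1
    by_contra hne
    have h1 := hsep _ _ (hU _) _ (hij ▸ hU _) hne _ (hmem _) _ (hmem _)
    have h2 := htri (f (Function.update y i (!y i))) (f y) (f (Function.update y j (!y j)))
    have h3 := hf1 y (Function.update y i (!y i))
    have h4 := hf1 y (Function.update y j (!y j))
    rw [hammingDist_update, Nat.cast_one, mul_one] at h3 h4
    rw [hsymm] at h3
    linarith

theorem asymptoticDimension_eq_top {X : Type} {d : X → X → ℝ}
    (h : ∀ k, ¬ AsymptoticDimensionLE d k) : asymptoticDimension d = ⊤ := by
  simp [asymptoticDimension, h]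

end Cubes

/-! ### Norms on the plane lattice are not hyperbolic -/

section Hyperbolic

open Filter Topology

/-- The four-point condition in terms of the sums of opposite distances. -/
theorem IsGromovHyperbolic.four_point {X : Type} {d : X → X → ℝ}
    (h : IsGromovHyperbolic d) :
    ∃ δ : ℝ, ∀ x y z w, d x z + d y w ≤ max (d x y + d z w) (d y z + d x w) + 2 * δ := by
  obtain ⟨δ, -, h⟩ := h
  refine ⟨δ, fun x y z w => ?_⟩
  have := h x y z w
  simp only [gromovProduct, tsub_le_iff_right, min_le_iff] at this
  rcases this with h | h
  · have := le_max_left (d x y + d z w) (d y z + d x w)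
    linarith
  · have := le_max_right (d x y + d z w) (d y z + d x w)
    linarith

/-- A subadditive symmetric function on `ℤ²` that grows at least linearly does not define a
hyperbolic metric: the associated stable norm would satisfy the four-point condition without an
error term, so that `min (‖x + y‖) (‖x - y‖) ≤ |‖x‖ - ‖y‖|`, which fails if `x` and `y` are
multiples of the two basis vectors of about the same norm. -/
theorem not_four_point_of_norm {ν : ℤ × ℤ → ℝ} (hadd : ∀ x y, ν (x + y) ≤ ν x + ν y) {c C : ℝ}
    (hc : 0 < c) (hlow : ∀ x, c * (|(x.1 : ℝ)| + |(x.2 : ℝ)|) - C ≤ ν x) (δ : ℝ)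
    (h4 : ∀ x y, ν (x + y) + ν (x - y) ≤ max (ν x + ν x) (ν y + ν y) + 2 * δ) : False := by
  have hsub : ∀ x, Subadditive fun k : ℕ => ν (k • x) := fun x k l => by
    simp only [add_smul]; exact hadd _ _
  have hbdd : ∀ x, BddBelow (Set.range fun k : ℕ => ν (k • x) / k) := by
    intro x
    refine ⟨-|C|, ?_⟩
    rintro _ ⟨k, rfl⟩
    rcases Nat.eq_zero_or_pos k with rfl | hk
    · simp
    · have hk1 : (1 : ℝ) ≤ k := by exact_mod_cast hk
      simp only
      rw [le_div_iff₀ (by linarith)]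
      have h1 := hlow (k • x)
      have h2 : 0 ≤ c * (|((k • x).1 : ℝ)| + |((k • x).2 : ℝ)|) := by positivity
      have h3 := le_abs_self C
      nlinarith [abs_nonneg C]
  -- The stable norm.
  let N : ℤ × ℤ → ℝ := fun x => (hsub x).lim
  have hN : ∀ x, Tendsto (fun k : ℕ => ν (k • x) / k) atTop (𝓝 (N x)) :=
    fun x => (hsub x).tendsto_lim (hbdd x)
  have hNlow : ∀ x, c * (|(x.1 : ℝ)| + |(x.2 : ℝ)|) ≤ N x := by
    intro x
    have hlim : Tendsto (fun k : ℕ => c * (|(x.1 : ℝ)| + |(x.2 : ℝ)|) - C / k) atTop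
        (𝓝 (c * (|(x.1 : ℝ)| + |(x.2 : ℝ)|) - 0)) :=
      tendsto_const_nhds.sub (tendsto_const_div_atTop_nhds_zero_nat C)
    rw [sub_zero] at hlim
    refine le_of_tendsto_of_tendsto hlim (hN x) ?_
    filter_upwards [eventually_gt_atTop 0] with k hk
    have hk1 : (0 : ℝ) < k := by exact_mod_cast hk
    rw [le_div_iff₀ hk1, sub_mul, div_mul_cancel₀ _ hk1.ne']
    refine le_trans (le_of_eq ?_) (hlow (k • x))
    simp [abs_mul]
    ring
  have hNsmul : ∀ (n : ℕ) x, N (n • x) = n * N x := by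
    intro n x
    rcases Nat.eq_zero_or_pos n with rfl | hn
    · have h0 : Tendsto (fun k : ℕ => ν (k • (0 : ℤ × ℤ)) / k) atTop (𝓝 0) := by
        simpa using tendsto_const_div_atTop_nhds_zero_nat (ν 0)
      simpa using tendsto_nhds_unique (hN 0) h0
    · have h1 : Tendsto (fun k : ℕ => (n : ℝ) * (ν ((k * n) • x) / ((k * n : ℕ) : ℝ))) atTop
          (𝓝 (n * N x)) :=
        ((hN x).comp (tendsto_id.atTop_mul_const' hn)).const_mul _
      refine tendsto_nhds_unique (hN _) (h1.congr fun k => ?_)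
      have : (n : ℝ) ≠ 0 := by positivity
      rw [mul_smul, Nat.cast_mul]
      field_simp
  have hN4 : ∀ x y, N (x + y) + N (x - y) ≤ max (N x + N x) (N y + N y) := by
    intro x y
    have hl := (hN (x + y)).add (hN (x - y))
    have hr := (((hN x).add (hN x)).max ((hN y).add (hN y))).add
      (tendsto_const_div_atTop_nhds_zero_nat (2 * δ))
    rw [add_zero] at hr
    refine le_of_tendsto_of_tendsto hl hr ?_
    filter_upwards [eventually_gt_atTop 0] with k hk
    have hk1 : (0 : ℝ) < k := by exact_mod_cast hk
    rw [← add_div, ← add_div, ← add_div, max_div_div_right hk1.le, ← add_div,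
      smul_add, smul_sub]
    exact div_le_div_of_nonneg_right (h4 _ _) hk1.le
  have hmin : ∀ x y, min (N (x + y)) (N (x - y)) ≤ |N x - N y| := by
    intro x y
    have h1 := hN4 x y
    have h2 := hN4 (x + y) (x - y)
    have e1 : x + y + (x - y) = 2 • x := by rw [two_smul]; abel
    have e2 : x + y - (x - y) = 2 • y := by rw [two_smul]; abel
    rw [e1, e2, hNsmul, hNsmul] at h2
    push_cast at h2
    rcases le_total (N x) (N y) with h | h <;>
    rcases le_total (N (x + y)) (N (x - y)) with h' | h'
    · rw [min_eq_left h', abs_of_nonpos (by linarith)]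
      rw [max_eq_right (by linarith)] at h1 h2
      linarith
    · rw [min_eq_right h', abs_of_nonpos (by linarith)]
      rw [max_eq_right (by linarith)] at h1
      rw [max_eq_left (by linarith)] at h2
      linarith
    · rw [min_eq_left h', abs_of_nonneg (by linarith)]
      rw [max_eq_left (by linarith)] at h1
      rw [max_eq_right (by linarith)] at h2
      linarith
    · rw [min_eq_right h', abs_of_nonneg (by linarith)]
      rw [max_eq_left (by linarith)] at h1 h2
      linarith
  -- Take multiples `(p, 0)` and `(0, q)` with `p * N (1, 0)` and `q * N (0, 1)` nearly equal.
  set N₁ := N (1, 0) with hN₁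
  set N₂ := N (0, 1) with hN₂
  have hN₁pos : c ≤ N₁ := by simpa using hNlow (1, 0)
  have hN₂pos : c ≤ N₂ := by simpa using hNlow (0, 1)
  obtain ⟨t, ht⟩ := exists_nat_gt ((N₁ + N₂) / c ^ 2 + 2 / c)
  set p := ⌊t * N₂⌋₊ with hp
  set q := ⌊t * N₁⌋₊ with hq
  have ht0 : (0 : ℝ) ≤ t := Nat.cast_nonneg t
  have hp1 : (p : ℝ) ≤ t * N₂ := Nat.floor_le (mul_nonneg ht0 (by linarith))
  have hp2 : t * N₂ < p + 1 := Nat.lt_floor_add_one _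
  have hq1 : (q : ℝ) ≤ t * N₁ := Nat.floor_le (mul_nonneg ht0 (by linarith))
  have hq2 : t * N₁ < q + 1 := Nat.lt_floor_add_one _
  have hm := hmin (p • (1, 0)) (q • (0, 1))
  rw [hNsmul, hNsmul] at hm
  have hlowpq : c * (p + q) ≤
      min (N (p • (1, 0) + q • (0, 1))) (N (p • (1, 0) - q • (0, 1))) := by
    have e1 : p • ((1, 0) : ℤ × ℤ) + q • (0, 1) = ((p : ℤ), (q : ℤ)) := by simp
    have e2 : p • ((1, 0) : ℤ × ℤ) - q • (0, 1) = ((p : ℤ), -(q : ℤ)) := by simp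
    rw [e1, e2]
    refine le_min ?_ ?_
    · simpa using hNlow ((p : ℤ), (q : ℤ))
    · simpa using hNlow ((p : ℤ), -(q : ℤ))
  have hdiff : |p * N₁ - q * N₂| ≤ N₁ + N₂ := by
    rw [abs_le]
    constructor <;> nlinarith
  have h1 := hlowpq.trans (hm.trans hdiff)
  have h2 : (N₁ + N₂) / c ^ 2 * c ^ 2 = N₁ + N₂ := by field_simp
  have h3 : 2 / c * c ^ 2 = 2 * c := by field_simp
  have h4 : (N₁ + N₂) + 2 * c < t * c ^ 2 := by
    have := mul_lt_mul_of_pos_right ht (pow_pos hc 2)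
    rw [add_mul, h2, h3] at this
    exact this
  have h5 : t * c ^ 2 ≤ c * (t * N₁) := by
    have := mul_le_mul_of_nonneg_left hN₁pos (mul_nonneg ht0 hc.le)
    nlinarith
  have h6 : 0 ≤ c * (t * N₂) := mul_nonneg hc.le (mul_nonneg ht0 (by linarith))
  nlinarith

end Hyperbolic

/-! ### Quasimorphisms bounded on the separable elements -/

section Blocks

/-- There are elements `g k` of the free group, which are uniformly short in terms of separable
elements, such that arbitrary weights in `{-1, 0, 1}` on the `g k` extend, up to uniformly bounded
errors, to quasimorphisms that are uniformly bounded on the separable elements. -/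
theorem exists_separating_blocks (α : Type) [Finite α] [Nontrivial α] :
    ∃ (g : ℕ → FreeGroup α) (Δ : ℝ), 0 ≤ Δ ∧ (∃ v i, ∀ k, ∃ r : ℕ, g k = v * FreeGroup.of i ^ r) ∧
      ∀ s : ℕ → ℤ, (∀ k, |s k| ≤ 1) → ∃ Q : FreeGroup α → ℝ, (∀ x, Q x⁻¹ = -Q x) ∧
        (∀ x y, |Q (x * y) - Q x - Q y| ≤ Δ) ∧ (∀ x, IsSeparableElement x → |Q x| ≤ Δ) ∧
        ∀ ks : List ℕ, |Q (ks.map g).prod - (ks.map s).sum| ≤ 1 := by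
  classical
  obtain ⟨i, j, hij⟩ := exists_pair_ne α
  obtain ⟨V, hV, hV', hpos, hpairs⟩ := exists_word j
  have hab : (i, true) ≠ (j, true) := by simpa using hij
  refine ⟨fun k => FreeGroup.mk V * FreeGroup.of i ^ (V.length + k), 24 * V.length, by positivity,
    ⟨_, i, fun k => ⟨_, rfl⟩⟩, fun s hs => ?_⟩
  have hs' : ∀ k, |s (k - V.length)| ≤ 1 := fun k => hs _
  refine ⟨fun x => (patternQuasi (i, true) (j, true) V (fun k => s (k - V.length)) x : ℝ),
    ?_, ?_, ?_, ?_⟩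
  · intro x
    simp only [patternQuasi_inv, Int.cast_neg]
  · intro x y
    have h := abs_patternQuasi_mul_le hab hV hs' x y
    have h' : (12 * V.length : ℤ) ≤ 24 * V.length := by omega
    beta_reduce
    exact_mod_cast h.trans h'
  · intro x hx
    beta_reduce
    exact_mod_cast abs_patternQuasi_le_of_separable hab hV hs' hpairs hx
  · intro ks
    have h := abs_patternQuasi_prod_le hij hV hV' hpos hs' (ks.map fun k => V.length + k)
      (by simp)
    simp only [List.map_map, Function.comp_def, Nat.add_sub_cancel_left] at h
    beta_reduce
    exact_mod_cast h

end Blocks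

/-! ### Flats and cubes in the Cayley graph -/

section Flats

/-- The map `x ↦ g 0 ^ x 0 * g 1 ^ x 1 * ⋯` on the lattice. -/
def latticeMap {G : Type} [Group G] (g : ℕ → G) (m : ℕ) (x : Fin m → ℤ) : G :=
  (List.ofFn fun j : Fin m => g j ^ x j).prod

/-- The image of a vertex of the cube in the lattice. -/
def cubeVertex {m : ℕ} (x : Fin m → Bool) (j : Fin m) : ℤ := if x j then 1 else 0

/-- The weights that measure the `ℓ¹` distance of `x` and `y`. -/
def signWeight {m : ℕ} (x y : Fin m → ℤ) (k : ℕ) : ℤ :=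
  if h : k < m then (x ⟨k, h⟩ - y ⟨k, h⟩).sign else 0

theorem abs_signWeight_le {m : ℕ} (x y : Fin m → ℤ) (k : ℕ) : |signWeight x y k| ≤ 1 := by
  rw [signWeight]
  split_ifs with h
  · rcases Int.sign_trichotomy (x ⟨k, h⟩ - y ⟨k, h⟩) with h | h | h <;> rw [h] <;> simp
  · simp

theorem latticeDist_eq_signWeight {m : ℕ} (x y : Fin m → ℤ) :
    latticeDist m x y = ∑ j, (x j : ℝ) * signWeight x y j - ∑ j, (y j : ℝ) * signWeight x y j := by
  rw [latticeDist, ← Finset.sum_sub_distrib]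
  refine Finset.sum_congr rfl fun j _ => ?_
  have : (|x j - y j| : ℤ) = x j * signWeight x y j - y j * signWeight x y j := by
    simp only [signWeight, j.isLt, dite_true, Fin.eta]
    rw [← sub_mul, mul_comm, Int.sign_mul_self_eq_abs]
  exact_mod_cast this

theorem latticeDist_cubeVertex {m : ℕ} (x y : Fin m → Bool) :
    latticeDist m (cubeVertex x) (cubeVertex y) = hammingDist x y := by
  rw [latticeDist, hammingDist, Finset.card_filter, Nat.cast_sum]
  refine Finset.sum_congr rfl fun j _ => ?_
  cases hx : x j <;> cases hy : y j <;> simp [cubeVertex, hx, hy]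

@[to_additive]
theorem List.prod_map_filter_eq {ι M : Type} [Monoid M] (l : List ι) (p : ι → Bool) (f : ι → M) :
    ((l.filter p).map f).prod = (l.map fun i => if p i then f i else 1).prod := by
  induction l with
  | nil => rfl
  | cons i l ih => by_cases h : p i <;> simp [h, ih]

section Quasi

variable {G : Type} [Group G] {Q : G → ℝ} {Δ : ℝ} {g : ℕ → G} {s : ℕ → ℤ}

theorem abs_quasi_prod_ofFn_le (hinv : ∀ x, Q x⁻¹ = -Q x)
    (hmul : ∀ x y, |Q (x * y) - Q x - Q y| ≤ Δ) {m : ℕ} (u : Fin m → G) :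
    |Q (List.ofFn u).prod - ∑ j, Q (u j)| ≤ m * Δ := by
  induction m with
  | zero =>
    have := hinv 1
    rw [inv_one] at this
    have h0 : Q 1 = 0 := by linarith
    simp [h0]
  | succ m ih =>
    rw [List.ofFn_succ, List.prod_cons, Fin.sum_univ_succ]
    have h1 := abs_le.1 (hmul (u 0) (List.ofFn fun j => u j.succ).prod)
    have h2 := abs_le.1 (ih fun j => u j.succ)
    push_cast
    rw [abs_le]
    constructor <;> linarith

theorem abs_quasi_zpow_le (hinv : ∀ x, Q x⁻¹ = -Q x)
    (hblock : ∀ ks : List ℕ, |Q (ks.map g).prod - (ks.map s).sum| ≤ 1) (k : ℕ) (z : ℤ) :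
    |Q (g k ^ z) - z * s k| ≤ 1 := by
  have hnat : ∀ r : ℕ, |Q (g k ^ r) - r * s k| ≤ 1 := by
    intro r
    simpa using hblock (List.replicate r k)
  obtain ⟨r, rfl | rfl⟩ := z.eq_nat_or_neg
  · simpa using hnat r
  · have := hnat r
    rw [zpow_neg, hinv, zpow_natCast, abs_sub_comm]
    convert this using 2
    push_cast
    ring

theorem abs_quasi_latticeMap_le (hinv : ∀ x, Q x⁻¹ = -Q x)
    (hmul : ∀ x y, |Q (x * y) - Q x - Q y| ≤ Δ)
    (hblock : ∀ ks : List ℕ, |Q (ks.map g).prod - (ks.map s).sum| ≤ 1) {m : ℕ} (x : Fin m → ℤ) :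
    |Q (latticeMap g m x) - ∑ j : Fin m, (x j : ℝ) * s j| ≤ m * Δ + m := by
  have h1 := abs_quasi_prod_ofFn_le hinv hmul fun j : Fin m => g j ^ x j
  have h2 : |∑ j : Fin m, Q (g j ^ x j) - ∑ j : Fin m, (x j : ℝ) * s j| ≤ m := by
    rw [← Finset.sum_sub_distrib]
    refine (Finset.abs_sum_le_sum_abs _ _).trans ?_
    refine (Finset.sum_le_sum fun (j : Fin m) _ => abs_quasi_zpow_le hinv hblock j (x j)).trans ?_
    simp
  exact (abs_sub_le _ _ _).trans (add_le_add h1 h2)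

/-- On the vertices of the cube the error does not depend on the dimension. -/
theorem abs_quasi_cube_le
    (hblock : ∀ ks : List ℕ, |Q (ks.map g).prod - (ks.map s).sum| ≤ 1) {m : ℕ}
    (x : Fin m → Bool) :
    |Q (latticeMap g m (cubeVertex x)) - ∑ j, (cubeVertex x j : ℝ) * s j| ≤ 1 := by
  have h := hblock (((List.finRange m).filter x).map (Fin.val : Fin m → ℕ))
  rw [List.map_map, List.map_map, List.prod_map_filter_eq, List.sum_map_filter_eq] at h
  have e1 : (fun j : Fin m => if x j then (g ∘ Fin.val) j else 1) =
      fun j : Fin m => g j ^ cubeVertex x j := by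
    funext j
    cases hx : x j <;> simp [cubeVertex, hx]
  have e2 : (fun j : Fin m => if x j then (s ∘ Fin.val) j else 0) =
      fun j : Fin m => cubeVertex x j * s j := by
    funext j
    cases hx : x j <;> simp [cubeVertex, hx]
  rw [e1, e2, ← List.ofFn_eq_map, ← List.ofFn_eq_map, List.sum_ofFn] at h
  exact_mod_cast h

end Quasi

/-- The blocks `g k` define maps from the lattices of all dimensions to the Cayley graph of the free
group with respect to the separable elements that are Lipschitz and have linear lower bounds. The
constants are uniform in the dimension, except for the additive one in the lower bound, and that one
is uniform on cubes. -/
theorem exists_latticeMap_bounds (α : Type) [Finite α] [Nontrivial α] :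
    ∃ (g : ℕ → FreeGroup α) (K A : ℝ), 0 ≤ K ∧ 0 ≤ A ∧
      (∀ m (x y : Fin m → ℤ), graphDist (leftCayleyGraph {g : FreeGroup α | IsSeparableElement g})
        (latticeMap g m x) (latticeMap g m y) ≤ K * latticeDist m x y) ∧
      (∀ m : ℕ, ∃ C : ℝ, 0 ≤ C ∧ ∀ x y : Fin m → ℤ, latticeDist m x y ≤
        A * graphDist (leftCayleyGraph {g : FreeGroup α | IsSeparableElement g})
          (latticeMap g m x) (latticeMap g m y) + C) ∧
      (∀ (m : ℕ) (x y : Fin m → Bool), (hammingDist x y : ℝ) ≤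
        A * graphDist (leftCayleyGraph {g : FreeGroup α | IsSeparableElement g})
          (latticeMap g m (cubeVertex x)) (latticeMap g m (cubeVertex y)) + 2) := by
  obtain ⟨g, Δ, hΔ, ⟨v, i, hg⟩, hQ⟩ := exists_separating_blocks α
  have hS := closure_isSeparableElement α
  have hconj : ∀ s ∈ {g : FreeGroup α | IsSeparableElement g}, ∀ h,
      h * s * h⁻¹ ∈ {g : FreeGroup α | IsSeparableElement g} :=
    fun s hs h => isSeparableElement_conj hs h
  set S := {g : FreeGroup α | IsSeparableElement g} with hSdef
  have hlip : ∀ Q : FreeGroup α → ℝ, (∀ x y, |Q (x * y) - Q x - Q y| ≤ Δ) →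
      (∀ x, IsSeparableElement x → |Q x| ≤ Δ) → ∀ u v,
      |Q u - Q v| ≤ 2 * Δ * graphDist (leftCayleyGraph S) u v := by
    intro Q hmul hsep
    refine abs_sub_le_mul_graphDist (leftCayleyGraph_connected hS) fun u v huv => ?_
    have key : ∀ t ∈ S, ∀ w, |Q (t * w) - Q w| ≤ 2 * Δ := by
      intro t ht w
      have h1 := abs_le.1 (hmul t w)
      have h2 := abs_le.1 (hsep t ht)
      rw [abs_le]
      constructor <;> linarith
    rcases (leftCayleyGraph_adj.1 huv).2 with ⟨t, ht, rfl⟩ | ⟨t, ht, rfl⟩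
    · rw [abs_sub_comm]; exact key t ht u
    · exact key t ht v
  refine ⟨g, graphDist (leftCayleyGraph S) 1 v + 1, 2 * Δ,
    add_nonneg (graphDist_nonneg _ _ _) zero_le_one, by positivity, ?_, ?_, ?_⟩
  · intro m x y
    refine (graphDist_prod_ofFn_le hS hconj _ _).trans ?_
    rw [latticeDist, Finset.mul_sum]
    refine Finset.sum_le_sum fun j _ => ?_
    refine (graphDist_zpow_le hS hconj _ _ _).trans ?_
    rw [mul_comm]
    refine mul_le_mul_of_nonneg_right ?_ (abs_nonneg _)
    obtain ⟨r, hr⟩ := hg j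
    have h1 := graphDist_mul_mul_le hS hconj 1 1 v (FreeGroup.of i ^ r)
    have h2 : graphDist (leftCayleyGraph S) 1 (FreeGroup.of i ^ r) ≤ 1 :=
      graphDist_one_le_one (isSeparableElement_of_pow i r)
    rw [mul_one, ← hr] at h1
    linarith
  · intro m
    refine ⟨2 * (m * Δ + m), by positivity, fun x y => ?_⟩
    obtain ⟨Q, hinv, hmul, hsep, hblock⟩ := hQ (signWeight x y) (abs_signWeight_le x y)
    have h1 := abs_le.1 (abs_quasi_latticeMap_le hinv hmul hblock x)
    have h2 := abs_le.1 (abs_quasi_latticeMap_le hinv hmul hblock y)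
    have h3 := (le_abs_self _).trans (hlip Q hmul hsep (latticeMap g m x) (latticeMap g m y))
    rw [latticeDist_eq_signWeight]
    linarith
  · intro m x y
    obtain ⟨Q, hinv, hmul, hsep, hblock⟩ :=
      hQ (signWeight (cubeVertex x) (cubeVertex y)) (abs_signWeight_le _ _)
    have h1 := abs_le.1 (abs_quasi_cube_le hblock x)
    have h2 := abs_le.1 (abs_quasi_cube_le hblock y)
    have h3 := (le_abs_self _).trans (hlip Q hmul hsep (latticeMap g m (cubeVertex x))
      (latticeMap g m (cubeVertex y)))
    rw [← latticeDist_cubeVertex, latticeDist_eq_signWeight]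
    linarith

end Flats

/-! ### Bi-invariant flats and the coarse geometry of the Cayley graph -/

section Conclusion

/-- A bi-invariant Cayley graph containing a linearly embedded flat `g ^ a * h ^ b` is not
hyperbolic. -/
theorem not_isGromovHyperbolic_of_flat {G : Type} [Group G] {S : Set G}
    (hS : Subgroup.closure S = ⊤) (hconj : ∀ s ∈ S, ∀ g, g * s * g⁻¹ ∈ S) {g h : G} {A C : ℝ}
    (hA : 0 ≤ A) (hlow : ∀ a b : ℤ, |(a : ℝ)| + |(b : ℝ)| ≤
      A * graphDist (leftCayleyGraph S) 1 (g ^ a * h ^ b) + C) :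
    ¬ IsGromovHyperbolic (graphDist (leftCayleyGraph S)) := by
  intro hyp
  obtain ⟨δ, h4⟩ := hyp.four_point
  let φ : ℤ × ℤ → G := fun x => g ^ x.1 * h ^ x.2
  -- Distances on the flat are translation invariant.
  have hdist : ∀ x y, graphDist (leftCayleyGraph S) (φ x) (φ y) =
      graphDist (leftCayleyGraph S) 1 (φ (y - x)) := by
    intro x y
    have e : (φ x)⁻¹ * φ y = h ^ (-x.2) * (g ^ (y.1 - x.1) * h ^ y.2) := by
      simp only [φ]; group
    have e' : g ^ (y.1 - x.1) * h ^ y.2 * h ^ (-x.2) = φ (y - x) := by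
      simp only [φ, Prod.fst_sub, Prod.snd_sub]; group
    rw [← graphDist_mul_left hS hconj (φ x)⁻¹, inv_mul_cancel, e,
      graphDist_one_mul_comm hS hconj, e']
  have hadd : ∀ x y, graphDist (leftCayleyGraph S) 1 (φ (x + y)) ≤
      graphDist (leftCayleyGraph S) 1 (φ x) + graphDist (leftCayleyGraph S) 1 (φ y) := by
    intro x y
    have := graphDist_triangle (leftCayleyGraph_connected hS) (φ 0) (φ x) (φ (x + y))
    simpa [hdist] using this
  have hneg : ∀ x, graphDist (leftCayleyGraph S) 1 (φ (-x)) =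
      graphDist (leftCayleyGraph S) 1 (φ x) := by
    intro x
    have := graphDist_comm (leftCayleyGraph S) (φ x) (φ 0)
    simpa [hdist] using this
  refine not_four_point_of_norm (ν := fun x => graphDist (leftCayleyGraph S) 1 (φ x)) hadd
    (c := (A + 1)⁻¹) (C := |C|) (by positivity) ?_ δ ?_
  · intro x
    have h1 := hlow x.1 x.2
    have h2 := graphDist_nonneg (leftCayleyGraph S) 1 (φ x)
    have h3 := le_abs_self C
    have h4 := abs_nonneg C
    rw [sub_le_iff_le_add, inv_mul_le_iff₀ (by positivity)]
    refine h1.trans ?_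
    change A * graphDist (leftCayleyGraph S) 1 (φ x) + C ≤ _
    nlinarith
  · intro x y
    have := h4 (φ 0) (φ x) (φ (x + y)) (φ y)
    simp only [hdist] at this
    have e1 : y - (x + y) = -x := by abel
    have e2 : y - x = -(x - y) := by abel
    have e3 : x + y - x = y := by abel
    rw [e1, e2, e3, hneg, hneg, sub_zero, sub_zero, sub_zero] at this
    exact this

theorem theorem1p4 (n : ℕ) (hn : 2 ≤ n) :
    (leftCayleyGraph (separableElements n)).Connected ∧
    (∀ m : ℕ, QuasiIsometricallyEmbeds (latticeDist m)
      (graphDist (leftCayleyGraph (separableElements n)))) ∧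
    ¬ IsGromovHyperbolic (graphDist (leftCayleyGraph (separableElements n))) ∧
    (leftCayleyGraph (separableElements n)).ediam = ⊤ ∧
    asymptoticDimension (graphDist (leftCayleyGraph (separableElements n))) = ⊤ := by
  have : Nontrivial (Fin n) := Fin.nontrivial_iff_two_le.2 hn
  have hS : Subgroup.closure (separableElements n) = ⊤ := closure_isSeparableElement (Fin n)
  have hconj : ∀ s ∈ separableElements n, ∀ g, g * s * g⁻¹ ∈ separableElements n :=
    fun s hs g => isSeparableElement_conj hs g
  have hcon := leftCayleyGraph_connected hS
  obtain ⟨g, K, A, hK, hA, hup, hlow, hcube⟩ := exists_latticeMap_bounds (Fin n)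
  change ∀ m (x y : Fin m → ℤ), graphDist (leftCayleyGraph (separableElements n)) _ _ ≤ _ at hup
  change ∀ m : ℕ, ∃ C : ℝ, 0 ≤ C ∧ ∀ x y : Fin m → ℤ, latticeDist m x y ≤
    A * graphDist (leftCayleyGraph (separableElements n)) _ _ + C at hlow
  change ∀ (m : ℕ) (x y : Fin m → Bool), (hammingDist x y : ℝ) ≤
    A * graphDist (leftCayleyGraph (separableElements n)) _ _ + 2 at hcube
  refine ⟨hcon, fun m => ?_, ?_, ?_, ?_⟩
  · obtain ⟨C, hC, hlow⟩ := hlow m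
    refine ⟨latticeMap g m, 1 + K + A, C, by linarith, hC, fun x y => ?_⟩
    have hd := graphDist_nonneg (leftCayleyGraph (separableElements n)) (latticeMap g m x)
      (latticeMap g m y)
    have hl : 0 ≤ latticeDist m x y := Finset.sum_nonneg fun _ _ => abs_nonneg _
    constructor
    · rw [sub_le_iff_le_add, inv_mul_le_iff₀ (by linarith)]
      refine (hlow x y).trans ?_
      nlinarith [mul_nonneg hK hd, mul_nonneg hK hC, mul_nonneg hA hC]
    · refine (hup m x y).trans ?_
      nlinarith [mul_nonneg hA hl]
  · obtain ⟨C, -, hlow⟩ := hlow 2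
    refine not_isGromovHyperbolic_of_flat hS hconj (g := g 0) (h := g 1) hA (C := C) ?_
    intro a b
    have := hlow 0 ![a, b]
    simpa [latticeDist, latticeMap, Fin.sum_univ_two] using this
  · by_contra hne
    obtain ⟨C, -, hlow⟩ := hlow 1
    obtain ⟨t, ht⟩ :=
      exists_nat_gt (A * (leftCayleyGraph (separableElements n)).diam + C)
    have h1 := hlow 0 fun _ => (t : ℤ)
    have h2 : graphDist (leftCayleyGraph (separableElements n)) (latticeMap g 1 0)
        (latticeMap g 1 fun _ => (t : ℤ)) ≤ (leftCayleyGraph (separableElements n)).diam := by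
      rw [graphDist]
      exact_mod_cast SimpleGraph.dist_le_diam hne
    have h3 := mul_le_mul_of_nonneg_left h2 hA
    have h4 : latticeDist 1 0 (fun _ => (t : ℤ)) = t := by simp [latticeDist]
    linarith
  · refine asymptoticDimension_eq_top ?_
    refine not_asymptoticDimensionLE_of_cubes (graphDist_triangle hcon) (graphDist_comm _) hK hA
      (C := 2) fun m => ⟨fun x => latticeMap g m (cubeVertex x), fun x y => ?_, hcube m⟩
    rw [← latticeDist_cubeVertex]
    exact hup m _ _

end Conclusion
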